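/- Notation. For $0<\theta<\pi$ let $\mathbb{H}_\theta$ be the quaternions $\mathbb{H}=\mathbb{R}^4$ with the pair of orthogonal complex structures given by left multiplication by $i$ and by $ie^{j\theta}=\cos(\theta)\,i+\sin(\theta)\,k$; let $\mathbb{C}$ and $\overline{\mathbb{C}}$ denote $\mathbb{C}=\mathbb{R}^2$ with the pairs $(i,i)$ and $(i,-i)$ respectively. A complex structure $J$ with $J(P)=P$ induces on a $2k$-plane $P$ the orientation of the bases $(v_1,Jv_1,\dots,v_k,Jv_k)$. Grassmannians, and the Grassmannian $\mathrm{Gr}^+_{2k}(V)$ of oriented $2k$-planes, carry their usual topology. Theorem. Let $V$ be a finite-dimensional real Euclidean vector space and let $J_0,J_1$ be orthogonal complex structures on $V$. Suppose that there is a linear isometry $\varphi$ from $$\mathbb{H}_{\theta_1}^{r_1}\oplus\cdots\oplus\mathbb{H}_{\theta_m}^{r_m}\oplus\mathbb{C}^{\ell}\oplus\overline{\mathbb{C}}^{s}$$ onto $V$ carrying the given pair of complex structures to $(J_0,J_1)$, where $0<\theta_1<\cdots<\theta_m<\pi$, $r_i>0$ and $m,\ell,s\ge 0$. Let $k\ge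 0$. Then the map $$(P_1,\dots,P_m,P',P'')\mapsto \varphi(P_1\oplus\cdots\oplus P_m\oplus P'\oplus P''),$$ where the image plane is given the orientation induced by $J_0$, is a homeomorphism from the disjoint union $$\coprod_{\substack{2t_1+\cdots+2t_m+\ell'+s'=k\\ 0\le t_i\le r_i,\ 0\le \ell'\le \ell,\ 0\le s'\le s}}\mathrm{Gr}^{\mathbb{H}}_{t_1}(\mathbb{H}^{r_1})\times\cdots\times\mathrm{Gr}^{\mathbb{H}}_{t_m}(\mathbb{H}^{r_m})\times\mathrm{Gr}^{\mathbb{C}}_{\ell'}(\mathbb{C}^{\ell})\times\mathrm{Gr}^{\mathbb{C}}_{s'}(\mathbb{C}^{s})$$ onto the subspace of $\mathrm{Gr}^+_{2k}(V)$ consisting of the $2k$-planes $P$ with $J_0(P)=P=J_1(P)$, oriented by $J_0$. (Here $\mathrm{Gr}^{\mathbb{H}}_t(\mathbb{H}^r)$ is the Grassmannian of $t$-dimensional left $\mathbb{H}$-subspaces of $\mathbb{H}^r$.) If both orientations of each plane are allowed, the space of oriented $2k$-planes stabilised by $J_0$ and $J_1$ is the disjoint union of this space and of its image under reversal of orientation.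 The complex structures $J_0$ and $J_1$ induce the same orientation on the planes of the piece with index $(t_1,\dots,t_m,\ell',s')$ if and only if $s'$ is even. -/

import Mathlib

open scoped Quaternion RealInnerProductSpace

noncomputable section

/-! ### Grassmannians -/

/-- The Grassmannian of `d`-dimensional linear subspaces of the `K`-vector space `V`. -/
structure Grass (K V : Type*) [DivisionRing K] [AddCommGroup V] [Module K V] (d : ℕ) where
  plane : Submodule K V
  finrank_eq : Module.finrank K plane = d

/-- The span of a linearly independent `d`-frame. -/
def Grass.ofFrame {K V : Type*} [DivisionRing K] [AddCommGroup V] [Module K V] {d : ℕ}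
    (v : {v : Fin d → V // LinearIndependent K v}) : Grass K V d where
  plane := Submodule.span K (Set.range v.1)
  finrank_eq := by simpa using finrank_span_eq_card v.2

/-- The topology of the Grassmannian: the quotient topology from the (non-compact) Stiefel
manifold of linearly independent `d`-frames, a subspace of `V ^ d`. -/
instance {K V : Type*} [DivisionRing K] [AddCommGroup V] [Module K V] [TopologicalSpace V]
    (d : ℕ) : TopologicalSpace (Grass K V d) :=
  TopologicalSpace.coinduced Grass.ofFrame inferInstance

/-- The Grassmannian of oriented `d`-dimensional linear subspaces of the real vector space `V`. -/
structure OrientedGrass (V : Type*) [AddCommGroup V] [Module ℝ V] (d : ℕ) where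
  plane : Submodule ℝ V
  finrank_eq : Module.finrank ℝ plane = d
  orientation : Orientation ℝ plane (Fin d)

/-- The span of a linearly independent `d`-frame, oriented by that frame. -/
def OrientedGrass.ofFrame {V : Type*} [AddCommGroup V] [Module ℝ V] {d : ℕ}
    (v : {v : Fin d → V // LinearIndependent ℝ v}) : OrientedGrass V d where
  plane := Submodule.span ℝ (Set.range v.1)
  finrank_eq := by simpa using finrank_span_eq_card v.2
  orientation := (Module.Basis.span v.2).orientation

/-- The topology of the oriented Grassmannian: the quotient topology from the space of linearly
independent `d`-frames. (For `d = 0` the space consists of two points, and is discrete.) -/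
instance {V : Type*} [AddCommGroup V] [Module ℝ V] [TopologicalSpace V] (d : ℕ) :
    TopologicalSpace (OrientedGrass V d) :=
  TopologicalSpace.coinduced OrientedGrass.ofFrame inferInstance

/-- The involution of the oriented Grassmannian that reverses the orientation of each plane. -/
def OrientedGrass.reverse {V : Type*} [AddCommGroup V] [Module ℝ V] {d : ℕ}
    (Q : OrientedGrass V d) : OrientedGrass V d where
  plane := Q.plane
  finrank_eq := Q.finrank_eq
  orientation := -Q.orientation

/-! ### Orthogonal complex structures -/

section Structures

variable {V W : Type*} [NormedAddCommGroup V] [InnerProductSpace ℝ V]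
  [NormedAddCommGroup W] [InnerProductSpace ℝ W]

/-- `J` is an orthogonal complex structure: `J² = -1` and `J` preserves the inner product. -/
structure IsOrthogonalComplexStructure (J : V →ₗ[ℝ] V) : Prop where
  sq : ∀ x, J (J x) = -x
  inner_map : ∀ x y, ⟪J x, J y⟫ = ⟪x, y⟫

/-- `φ` is an isomorphism of pairs of orthogonal complex structures from `(V, J₀, J₁)` to
`(W, J₀', J₁')`: an orthogonal map with `J_i' = φ J_i φ⁻¹`. -/
structure IsPairIso (J₀ J₁ : V →ₗ[ℝ] V) (J₀' J₁' : W →ₗ[ℝ] W) (φ : V ≃ₗᵢ[ℝ] W) : Prop where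
  map_fst : ∀ x, φ (J₀ x) = J₀' (φ x)
  map_snd : ∀ x, φ (J₁ x) = J₁' (φ x)

/-- The plane `P` is stabilised by `J`: `J(P) = P`. -/
def Stabilises (J : V →ₗ[ℝ] V) (P : Submodule ℝ V) : Prop :=
  P.map J = P

/-- The complex structure `J` induces the orientation `o` on the `2k`-plane `P`: the orientation
`o` is the one of a real basis `(v₁, J v₁, …, v_k, J v_k)` of `P`. -/
def InducesOrientation (J : V →ₗ[ℝ] V) {k : ℕ} (P : Submodule ℝ V)
    (o : Orientation ℝ P (Fin (2 * k))) : Prop :=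
  ∃ b : Module.Basis (Fin (2 * k)) ℝ P,
    (∀ a : Fin k, (b ⟨2 * a + 1, by omega⟩ : V) = J (b ⟨2 * a, by omega⟩ : V)) ∧
      b.orientation = o

/-- `J₀` and `J₁` induce the same orientation on the `2k`-plane underlying `Q`. -/
def InduceSameOrientation (J₀ J₁ : V →ₗ[ℝ] V) {k : ℕ} (Q : OrientedGrass V (2 * k)) : Prop :=
  ∃ o : Orientation ℝ Q.plane (Fin (2 * k)),
    InducesOrientation J₀ Q.plane o ∧ InducesOrientation J₁ Q.plane o

/-- The oriented `2k`-planes stabilised by both `J₀` and `J₁` (with either orientation). -/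
def stabilisedPlanes (J₀ J₁ : V →ₗ[ℝ] V) (k : ℕ) : Set (OrientedGrass V (2 * k)) :=
  {Q | Stabilises J₀ Q.plane ∧ Stabilises J₁ Q.plane}

/-- The oriented `2k`-planes stabilised by both `J₀` and `J₁` that carry the orientation induced
by `J₀`. -/
def stabilisedComplexPlanes (J₀ J₁ : V →ₗ[ℝ] V) (k : ℕ) : Set (OrientedGrass V (2 * k)) :=
  {Q | Stabilises J₀ Q.plane ∧ Stabilises J₁ Q.plane ∧
    InducesOrientation J₀ Q.plane Q.orientation}

end Structures

/-! ### The model `ℍ_{θ₁}^{r₁} ⊕ ⋯ ⊕ ℍ_{θ_m}^{r_m} ⊕ ℂ^ℓ ⊕ ℂ̄^s` -/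

/-- `ℍ^r` with its Euclidean norm, a left `ℍ`-module. -/
abbrev QuaternionSpace (r : ℕ) : Type := PiLp 2 (fun _ : Fin r => ℍ[ℝ])

/-- `ℂ^ℓ` with its Euclidean norm. -/
abbrev ComplexSpace (l : ℕ) : Type := PiLp 2 (fun _ : Fin l => ℂ)

/-- The Euclidean space `ℍ^{r₁} ⊕ ⋯ ⊕ ℍ^{r_m} ⊕ ℂ^ℓ ⊕ ℂ^s` (orthogonal direct sum). -/
abbrev ModelSpace {m : ℕ} (r : Fin m → ℕ) (l s : ℕ) : Type :=
  WithLp 2 (PiLp 2 (fun i : Fin m => QuaternionSpace (r i)) ×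
    WithLp 2 (ComplexSpace l × ComplexSpace s))

/-- Coordinatewise left multiplication by `α i` on `ℍ^{r i}`, by `β` on `ℂ^ℓ` and by `γ` on
`ℂ^s`. -/
def modelMul {m : ℕ} (r : Fin m → ℕ) (l s : ℕ) (α : Fin m → ℍ[ℝ]) (β γ : ℂ) :
    ModelSpace r l s →ₗ[ℝ] ModelSpace r l s where
  toFun x := WithLp.toLp 2
    (WithLp.toLp 2 (fun i => WithLp.toLp 2 (fun a => α i * x.fst i a)),
      WithLp.toLp 2
        (WithLp.toLp 2 (fun a => β * x.snd.fst a), WithLp.toLp 2 (fun a => γ * x.snd.snd a)))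
  map_add' x y := by
    refine congrArg (WithLp.toLp 2) (Prod.ext ?_ (congrArg (WithLp.toLp 2) (Prod.ext ?_ ?_)))
    · ext1 i; ext1 a; exact mul_add _ _ _
    · ext1 a; exact mul_add _ _ _
    · ext1 a; exact mul_add _ _ _
  map_smul' c x := by
    refine congrArg (WithLp.toLp 2) (Prod.ext ?_ (congrArg (WithLp.toLp 2) (Prod.ext ?_ ?_)))
    · ext1 i; ext1 a; exact mul_smul_comm c (α i) (x.fst i a)
    · ext1 a; exact mul_smul_comm c β (x.snd.fst a)
    · ext1 a; exact mul_smul_comm c γ (x.snd.snd a)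

/-- The quaternion `i`. -/
def quaternionI : ℍ[ℝ] := ⟨0, 1, 0, 0⟩

/-- The quaternion `i e^{jt} = cos t i + sin t k`. -/
def quaternionRot (t : ℝ) : ℍ[ℝ] := ⟨0, Real.cos t, 0, Real.sin t⟩

/-- The first complex structure of the model: left multiplication by `i` on every summand. -/
def modelJ₀ {m : ℕ} (r : Fin m → ℕ) (l s : ℕ) : ModelSpace r l s →ₗ[ℝ] ModelSpace r l s :=
  modelMul r l s (fun _ => quaternionI) Complex.I Complex.I

/-- The second complex structure of the model: left multiplication by
`i e^{jθ} = cos θ i + sin θ k` on the summands `ℍ_θ`, by `i` on `ℂ` and by `-i` on `ℂ̄`. -/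
def modelJ₁ {m : ℕ} (θ : Fin m → ℝ) (r : Fin m → ℕ) (l s : ℕ) :
    ModelSpace r l s →ₗ[ℝ] ModelSpace r l s :=
  modelMul r l s (fun i => quaternionRot (θ i)) Complex.I (-Complex.I)

/-! ### The disjoint union of products of Grassmannians -/

/-- The indices `(t₁, …, t_m, ℓ', s')` with `0 ≤ t_i ≤ r_i`, `0 ≤ ℓ' ≤ ℓ`, `0 ≤ s' ≤ s` and
`2 ∑ t_i + ℓ' + s' = k`. -/
structure PieceIndex {m : ℕ} (r : Fin m → ℕ) (l s k : ℕ) where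
  t : Fin m → ℕ
  l' : ℕ
  s' : ℕ
  t_le : ∀ i, t i ≤ r i
  l'_le : l' ≤ l
  s'_le : s' ≤ s
  sum_eq : 2 * ∑ i, t i + l' + s' = k

/-- `Gr_{t₁}(ℍ^{r₁}) × ⋯ × Gr_{t_m}(ℍ^{r_m}) × Gr_{ℓ'}(ℂ^ℓ) × Gr_{s'}(ℂ^s)`. -/
abbrev Piece {m : ℕ} (r : Fin m → ℕ) (l s k : ℕ) (c : PieceIndex r l s k) : Type :=
  (∀ i, Grass ℍ[ℝ] (QuaternionSpace (r i)) (c.t i)) ×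
    Grass ℂ (ComplexSpace l) c.l' × Grass ℂ (ComplexSpace s) c.s'

/-- The disjoint union of all the pieces. -/
abbrev PieceUnion {m : ℕ} (r : Fin m → ℕ) (l s k : ℕ) : Type :=
  Σ c : PieceIndex r l s k, Piece r l s k c

/-- The disjoint union topology (a shortcut to the instance that Lean finds anyway). -/
instance {m : ℕ} (r : Fin m → ℕ) (l s k : ℕ) : TopologicalSpace (PieceUnion r l s k) :=
  instTopologicalSpaceSigma

/-- The real subspace `P₁ ⊕ ⋯ ⊕ P_m ⊕ P' ⊕ P''` of the model space. -/
def Piece.directSum {m : ℕ} {r : Fin m → ℕ} {l s k : ℕ} {c : PieceIndex r l s k}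
    (p : Piece r l s k c) : Submodule ℝ (ModelSpace r l s) where
  carrier := {x | (∀ i, x.fst i ∈ (p.1 i).plane) ∧
    x.snd.fst ∈ p.2.1.plane ∧ x.snd.snd ∈ p.2.2.plane}
  zero_mem' := ⟨fun i => (p.1 i).plane.zero_mem, p.2.1.plane.zero_mem, p.2.2.plane.zero_mem⟩
  add_mem' hx hy := ⟨fun i => (p.1 i).plane.add_mem (hx.1 i) (hy.1 i),
    p.2.1.plane.add_mem hx.2.1 hy.2.1, p.2.2.plane.add_mem hx.2.2 hy.2.2⟩
  smul_mem' a _ hx := ⟨fun i => ((p.1 i).plane.restrictScalars ℝ).smul_mem a (hx.1 i),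
    (p.2.1.plane.restrictScalars ℝ).smul_mem a hx.2.1,
    (p.2.2.plane.restrictScalars ℝ).smul_mem a hx.2.2⟩

end

open scoped Quaternion RealInnerProductSpace

noncomputable section

/-! A plane stable under `J₀` and `J₁` is stable under `-(J₀J₁ + J₁J₀)/2`. On the model this
operator is the scalar `cos θ_i` on `ℍ_{θ_i}^{r_i}`, `1` on `ℂ^ℓ` and `-1` on `ℂ̄^s`. These values
are distinct, so interpolating polynomials in the operator are the projections onto the summands,
and a stable plane is the sum of its intersections with them (`modelMul_real_mem`,
`exists_directSum_eq`). As `sin θ_i ≠ 0`, the quaternions `i` and `ie^{jθ_i}` generate `ℍ` as a real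
algebra, so the quaternionic components are `ℍ`-subspaces. This gives the bijection on planes.

The bijection is continuous because frames of the factors depend continuously on nothing but
themselves and yield a real frame of the sum, and the frame spaces map onto the pieces by open
quotient maps (`continuous_orientedImage`). It is an embedding because the source is compact, by
Gram-Schmidt (`Grass.compactSpace`), and the oriented Grassmannian is Hausdorff, by Plücker
coordinates.

The orientation induced by a complex structure is unique, since complex linear automorphisms have
positive real determinant (`InducesOrientation.unique`). To compare the two orientations, left
multiplication by `e^{-jθ/2}` carries `i` to `ie^{jθ}` and preserves orientation, being a square;
each complex line in `ℂ̄^s` contributes a sign `-1`. The total sign is `(-1)^{s'}`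
(`orientation_realBasisSnd_eq_iff`). -/

/-! ### Grassmannians as open quotients of frame spaces -/

theorem Grass.plane_injective {K V : Type*} [DivisionRing K] [AddCommGroup V] [Module K V] {d : ℕ} :
    Function.Injective (Grass.plane : Grass K V d → Submodule K V) := by
  rintro ⟨P, hP⟩ ⟨Q, hQ⟩ h
  cases h
  rfl

theorem exists_linearIndependent_span_eq {K V : Type*} [DivisionRing K] [AddCommGroup V]
    [Module K V] [Module.Finite K V] {d : ℕ} {P : Submodule K V} (hP : Module.finrank K P = d) :
    ∃ v : Fin d → V, LinearIndependent K v ∧ Submodule.span K (Set.range v) = P := by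
  let b := Module.finBasisOfFinrankEq K P hP
  refine ⟨fun i => b i, b.linearIndependent.map' P.subtype P.ker_subtype, ?_⟩
  have := congrArg (Submodule.map P.subtype) b.span_eq
  rwa [Submodule.map_span, ← Set.range_comp, Submodule.map_top, Submodule.range_subtype] at this

theorem Grass.ofFrame_surjective {K V : Type*} [DivisionRing K] [AddCommGroup V] [Module K V]
    [Module.Finite K V] {d : ℕ} : Function.Surjective (Grass.ofFrame (K := K) (V := V) (d := d)) := by
  intro P
  obtain ⟨v, hv, h⟩ := exists_linearIndependent_span_eq P.finrank_eq
  exact ⟨⟨v, hv⟩, Grass.plane_injective h⟩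

/-- Frames of the same plane differ by an invertible matrix, which acts continuously on frames, hence
the span map is open. -/
theorem Grass.isOpenMap_ofFrame {K V : Type*} [DivisionRing K] [AddCommGroup V] [Module K V]
    [TopologicalSpace V] [ContinuousAdd V] [ContinuousConstSMul K V] {d : ℕ} :
    IsOpenMap (Grass.ofFrame (K := K) (V := V) (d := d)) := by
  intro U hU
  refine isOpen_coinduced.2 ?_
  rw [isOpen_iff_forall_mem_open]
  rintro w ⟨u, hu, huw⟩
  have hspan : Submodule.span K (Set.range u.1) = Submodule.span K (Set.range w.1) :=
    congrArg Grass.plane huw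
  have hA : ∀ i, ∃ c : Fin d → K, ∑ j, c j • w.1 j = u.1 i := fun i =>
    (Submodule.mem_span_range_iff_exists_fun K).1
      (hspan ▸ Submodule.subset_span (Set.mem_range_self i))
  have hB : ∀ i, ∃ c : Fin d → K, ∑ j, c j • u.1 j = w.1 i := fun i =>
    (Submodule.mem_span_range_iff_exists_fun K).1
      (hspan ▸ Submodule.subset_span (Set.mem_range_self i))
  choose A hA using hA
  choose B hB using hB
  -- The one-sided inverse `BA = 1` is enough for `A` to preserve spans, and it needs no determinant
  -- over the possibly noncommutative `K`.
  have hBA : ∀ i k, ∑ j, B i j * A j k = if i = k then 1 else 0 := by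
    intro i
    have h1 : ∑ k, (∑ j, B i j * A j k) • w.1 k = w.1 i := by
      simp_rw [Finset.sum_smul, mul_smul]
      rw [Finset.sum_comm]
      simp_rw [← Finset.smul_sum, hA, hB]
    have h2 : ∑ k, ((∑ j, B i j * A j k) - if i = k then 1 else 0) • w.1 k = 0 := by
      simp [sub_smul, Finset.sum_sub_distrib, h1]
    intro k
    exact sub_eq_zero.1 (Fintype.linearIndependent_iff.1 w.2 _ h2 k)
  let T : (Fin d → V) → (Fin d → V) := fun x i => ∑ k, A i k • x k
  have hBT : ∀ (x : Fin d → V) i, ∑ j, B i j • T x j = x i := by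
    intro x i
    simp only [T, Finset.smul_sum, smul_smul]
    rw [Finset.sum_comm]
    simp [← Finset.sum_smul, hBA]
  have hTspan : ∀ x : Fin d → V, Submodule.span K (Set.range (T x)) =
      Submodule.span K (Set.range x) := by
    intro x
    apply le_antisymm <;> rw [Submodule.span_le] <;> rintro _ ⟨i, rfl⟩
    · exact Submodule.sum_mem _ fun k _ => Submodule.smul_mem _ _
        (Submodule.subset_span (Set.mem_range_self k))
    · rw [← hBT x i]
      exact Submodule.sum_mem _ fun k _ => Submodule.smul_mem _ _
        (Submodule.subset_span (Set.mem_range_self k))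
  have hTind : ∀ x : Fin d → V, LinearIndependent K x → LinearIndependent K (T x) := by
    intro x hx
    rw [linearIndependent_iff_card_eq_finrank_span, Set.finrank, hTspan, finrank_span_eq_card hx]
  have hTc : Continuous T := by fun_prop
  let T' : {v : Fin d → V // LinearIndependent K v} → {v : Fin d → V // LinearIndependent K v} :=
    fun x => ⟨T x.1, hTind x.1 x.2⟩
  have hT'c : Continuous T' := by fun_prop
  refine ⟨T' ⁻¹' U, fun x hx => ⟨T' x, hx, Grass.plane_injective (hTspan x.1)⟩, hU.preimage hT'c, ?_⟩
  have : T' w = u := Subtype.ext (funext hA)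
  simpa [this] using hu

theorem Grass.continuous_ofFrame {K V : Type*} [DivisionRing K] [AddCommGroup V] [Module K V]
    [TopologicalSpace V] {d : ℕ} : Continuous (Grass.ofFrame (K := K) (V := V) (d := d)) :=
  continuous_coinduced_rng

theorem Grass.isOpenQuotientMap_ofFrame {K V : Type*} [DivisionRing K] [AddCommGroup V]
    [Module K V] [Module.Finite K V] [TopologicalSpace V] [ContinuousAdd V]
    [ContinuousConstSMul K V] {d : ℕ} :
    IsOpenQuotientMap (Grass.ofFrame (K := K) (V := V) (d := d)) :=
  ⟨ofFrame_surjective, continuous_ofFrame, isOpenMap_ofFrame⟩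

/-! ### Compactness of Grassmannians by orthonormalisation -/

section Compact

variable {K V : Type*} [DivisionRing K] [NormedAddCommGroup V] [InnerProductSpace ℝ V] [Module K V]

/-- Families of unit vectors spanning pairwise orthogonal `K`-lines. -/
def unitaryFrames (K V : Type*) [DivisionRing K] [NormedAddCommGroup V]
    [InnerProductSpace ℝ V] [Module K V] (d : ℕ) : Set (Fin d → V) :=
  {v | (∀ i, ‖v i‖ = 1) ∧ ∀ i j, i ≠ j → ∀ a : K, ⟪a • v i, v j⟫ = 0}

/-- The frames form a closed subset of a product of unit spheres. Letting `a` range over all scalars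
makes the real inner product express Hermitian orthogonality, over `ℂ` and `ℍ` alike. -/
theorem isCompact_unitaryFrames [FiniteDimensional ℝ V] [ContinuousConstSMul K V] (d : ℕ) :
    IsCompact (unitaryFrames K V d) := by
  have : ProperSpace V := FiniteDimensional.proper ℝ V
  refine (isCompact_univ_pi fun _ : Fin d => isCompact_sphere (0 : V) 1).of_isClosed_subset ?_ ?_
  · simp only [unitaryFrames, Set.ofPred_and, Set.ofPred_forall]
    refine IsClosed.inter (isClosed_iInter fun i => isClosed_eq (by fun_prop) (by fun_prop))
      (isClosed_iInter fun i => isClosed_iInter fun j => isClosed_iInter fun _ =>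
        isClosed_iInter fun a => isClosed_eq ?_ (by fun_prop))
    exact Continuous.inner (by fun_prop) (by fun_prop)
  · intro v hv i _
    simpa using hv.1 i

/-- Pairing a linear relation with its own `j`-th term leaves the squared norm of that term. The
hypothesis `hadj` gives each scalar an adjoint, which moves all scalars to one side. -/
theorem linearIndependent_of_mem_unitaryFrames
    (hadj : ∀ a : K, ∃ a' : K, ∀ x y : V, ⟪a • x, y⟫ = ⟪x, a' • y⟫) {d : ℕ} {v : Fin d → V}
    (hv : v ∈ unitaryFrames K V d) : LinearIndependent K v := by
  rw [Fintype.linearIndependent_iff]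
  intro c hc j
  obtain ⟨a', ha'⟩ := hadj (c j)
  have h : ⟪c j • v j, ∑ i, c i • v i⟫ = ⟪c j • v j, c j • v j⟫ := by
    rw [inner_sum]
    refine Finset.sum_eq_single j (fun i _ hij => ?_) (by simp)
    rw [ha', real_inner_comm, smul_smul]
    rw [real_inner_comm, ← real_inner_comm]
    exact hv.2 i j hij _
  rw [hc, inner_zero_right] at h
  have h0 := inner_self_eq_zero.1 h.symm
  refine (smul_eq_zero.1 h0).resolve_right fun h1 => ?_
  simpa [h1] using hv.1 j

variable [Algebra ℝ K] [IsScalarTower ℝ K V] [FiniteDimensional ℝ V]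

/-- Gram-Schmidt: take a vector of `P` outside the span `W` so far and remove its real orthogonal
projection to `W`. Because `W` is a `K`-subspace, the rest is orthogonal to whole `K`-lines. -/
theorem exists_mem_unitaryFrames
    (hadj : ∀ a : K, ∃ a' : K, ∀ x y : V, ⟪a • x, y⟫ = ⟪x, a' • y⟫) (P : Submodule K V) (n : ℕ)
    (hn : n ≤ Module.finrank K P) : ∃ v ∈ unitaryFrames K V n, ∀ i, v i ∈ P := by
  induction n with
  | zero => exact ⟨Fin.elim0, ⟨fun i => i.elim0, fun i => i.elim0⟩, fun i => i.elim0⟩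
  | succ n ih =>
    obtain ⟨v, hv, hvP⟩ := ih (by omega)
    let W := Submodule.span K (Set.range v)
    have hWP : W ≤ P := Submodule.span_le.2 (by rintro _ ⟨i, rfl⟩; exact hvP i)
    have hW : Module.finrank K W = n := by
      simpa using finrank_span_eq_card (linearIndependent_of_mem_unitaryFrames hadj hv)
    obtain ⟨y, hyP, hyW⟩ : ∃ y ∈ P, y ∉ W := by
      by_contra! h
      have : W = P := le_antisymm hWP h
      rw [this] at hW
      omega
    obtain ⟨y₁, hy₁, y₂, hy₂, rfl⟩ := (W.restrictScalars ℝ).exists_add_mem_mem_orthogonal y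
    have hy₁W : y₁ ∈ W := hy₁
    have hy₂P : y₂ ∈ P := by simpa using P.sub_mem hyP (hWP hy₁W)
    have hy₂0 : y₂ ≠ 0 := by
      rintro rfl
      exact hyW (by simpa using hy₁W)
    have horth : ∀ (a : K) i, ⟪a • v i, (‖y₂‖⁻¹ : ℝ) • y₂⟫ = 0 := fun a i => by
      rw [inner_smul_right, (Submodule.mem_orthogonal _ _).1 hy₂ (a • v i)
        (W.smul_mem a (Submodule.subset_span (Set.mem_range_self i))), mul_zero]
    refine ⟨Fin.snoc v ((‖y₂‖⁻¹ : ℝ) • y₂), ⟨fun i => ?_, fun i j hij a => ?_⟩, fun i => ?_⟩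
    · refine Fin.lastCases ?_ (fun i => ?_) i
      · simp [norm_smul, hy₂0]
      · simpa using hv.1 i
    · induction i using Fin.lastCases with
      | last =>
        induction j using Fin.lastCases with
        | last => exact absurd rfl hij
        | cast j =>
          obtain ⟨a', ha'⟩ := hadj a
          rw [Fin.snoc_last, Fin.snoc_castSucc, ha', real_inner_comm]
          exact horth a' j
      | cast i =>
        induction j using Fin.lastCases with
        | last => simpa using horth a i
        | cast j =>
          rw [Fin.snoc_castSucc, Fin.snoc_castSucc]
          exact hv.2 i j (fun h => hij (by rw [h])) a
    · refine Fin.lastCases ?_ (fun i => ?_) i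
      · rw [Fin.snoc_last]
        exact (P.restrictScalars ℝ).smul_mem _ hy₂P
      · simpa using hvP i

theorem Grass.compactSpace [Module.Finite K V] [ContinuousConstSMul K V]
    (hadj : ∀ a : K, ∃ a' : K, ∀ x y : V, ⟪a • x, y⟫ = ⟪x, a' • y⟫) (d : ℕ) :
    CompactSpace (Grass K V d) := by
  have : CompactSpace (unitaryFrames K V d) := isCompact_iff_compactSpace.1
    (isCompact_unitaryFrames d)
  let f : unitaryFrames K V d → Grass K V d := fun v =>
    Grass.ofFrame ⟨v.1, linearIndependent_of_mem_unitaryFrames hadj v.2⟩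
  have hfc : Continuous f := continuous_ofFrame.comp (continuous_subtype_val.subtype_mk _)
  refine Function.Surjective.compactSpace hfc fun P => ?_
  obtain ⟨v, hv, hvP⟩ := exists_mem_unitaryFrames hadj P.plane d P.finrank_eq.ge
  refine ⟨⟨v, hv⟩, Grass.plane_injective (Submodule.eq_of_le_of_finrank_eq ?_ ?_)⟩
  · exact Submodule.span_le.2 (by rintro _ ⟨i, rfl⟩; exact hvP i)
  · exact (f ⟨v, hv⟩).finrank_eq.trans P.finrank_eq.symm

end Compact

/-! ### Oriented Grassmannians: frames, reversal, and the Hausdorff property -/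

namespace OrientedGrass

section Algebraic

variable {V : Type*} [AddCommGroup V] [Module ℝ V] {d : ℕ}

theorem mk_eq_ofFrame {v : {v : Fin d → V // LinearIndependent ℝ v}} {P : Submodule ℝ V}
    (hd : Module.finrank ℝ P = d) (b : Module.Basis (Fin d) ℝ P) (hb : ∀ i, (b i : V) = v.1 i)
    {o : Orientation ℝ P (Fin d)} (ho : b.orientation = o) :
    (⟨P, hd, o⟩ : OrientedGrass V d) = ofFrame v := by
  have hP : P = Submodule.span ℝ (Set.range v.1) := by
    have := congrArg (Submodule.map P.subtype) b.span_eq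
    rw [Submodule.map_span, ← Set.range_comp, Submodule.map_top, Submodule.range_subtype] at this
    rw [← this, show P.subtype ∘ b = v.1 from funext hb]
  subst hP
  have : b = Module.Basis.span v.2 := Module.Basis.eq_of_apply_eq fun i =>
    (Subtype.ext (hb i)).trans (Module.Basis.span_apply v.2 i).symm
  subst this
  subst ho
  rfl

theorem eq_ofFrame_iff (Q : OrientedGrass V d) (v : {v : Fin d → V // LinearIndependent ℝ v}) :
    Q = ofFrame v ↔ ∃ b : Module.Basis (Fin d) ℝ Q.plane,
      (∀ i, (b i : V) = v.1 i) ∧ b.orientation = Q.orientation := by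
  constructor
  · rintro rfl
    exact ⟨Module.Basis.span v.2, fun i => congrArg Subtype.val (Module.Basis.span_apply v.2 i), rfl⟩
  · rintro ⟨b, hb, ho⟩
    exact mk_eq_ofFrame Q.finrank_eq b hb ho

/-- For `d = 0` the empty frame reaches only one of the two orientations, hence `hd`. -/
theorem ofFrame_surjective (hd : d ≠ 0) [Module.Finite ℝ V] :
    Function.Surjective (ofFrame (V := V) (d := d)) := by
  intro Q
  have : Nonempty (Fin d) := ⟨⟨0, Nat.pos_of_ne_zero hd⟩⟩
  let b := (Module.finBasisOfFinrankEq ℝ Q.plane Q.finrank_eq).adjustToOrientation Q.orientation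
  refine ⟨⟨fun i => b i, b.linearIndependent.map' Q.plane.subtype Q.plane.ker_subtype⟩, ?_⟩
  exact ((eq_ofFrame_iff _ _).2 ⟨b, fun _ => rfl,
    Module.Basis.orientation_adjustToOrientation _ _⟩).symm

theorem exists_matrix_of_basis {P : Submodule ℝ V} (b b' : Module.Basis (Fin d) ℝ P) :
    ∃ A : Matrix (Fin d) (Fin d) ℝ, (∀ i, (b' i : V) = ∑ j, A i j • (b j : V)) ∧
      A.det = b.det b' := by
  refine ⟨(b.toMatrix b').transpose, fun i => ?_, ?_⟩
  · refine (congrArg Subtype.val (b.sum_toMatrix_smul_self b' i)).symm.trans ?_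
    simp only [AddSubmonoidClass.coe_finsetSum, Submodule.coe_smul, Matrix.transpose_apply]
  · rw [Matrix.det_transpose, Module.Basis.det_apply]

theorem reverse_ofFrame {d : ℕ} (v w : {v : Fin (d + 1) → V // LinearIndependent ℝ v})
    (hw : w.1 = Function.update v.1 0 (-v.1 0)) : (ofFrame v).reverse = ofFrame w := by
  suffices h : ∀ i, (((Module.Basis.span v.2).unitsSMul (Function.update 1 0 (-1)) i :
      Submodule.span ℝ (Set.range v.1)) : V) = w.1 i from
    (eq_ofFrame_iff _ _).2 ⟨(Module.Basis.span v.2).unitsSMul (Function.update 1 0 (-1)), h,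
      Module.Basis.orientation_neg_single _ _⟩
  intro i
  rw [hw, Module.Basis.unitsSMul_apply]
  by_cases hi : i = 0
  · subst hi
    simp [Module.Basis.span_apply]
  · simp [Function.update_of_ne hi, Module.Basis.span_apply]

end Algebraic

section Topological

variable {V : Type*} [AddCommGroup V] [Module ℝ V] [TopologicalSpace V] {d : ℕ}

theorem continuous_ofFrame : Continuous (ofFrame (V := V) (d := d)) :=
  continuous_coinduced_rng

theorem continuous_iff {X : Type*} [TopologicalSpace X] {f : OrientedGrass V d → X} :
    Continuous f ↔ Continuous (f ∘ ofFrame) :=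
  continuous_coinduced_dom

/-- There is a single empty frame, so every set has open preimage. -/
instance : DiscreteTopology (OrientedGrass V 0) := by
  have : Subsingleton {v : Fin 0 → V // LinearIndependent ℝ v} :=
    ⟨fun _ _ => Subtype.ext (Subsingleton.elim _ _)⟩
  refine discreteTopology_iff_forall_isOpen.2 fun s => ?_
  exact isOpen_coinduced.2 (isOpen_discrete _)

theorem continuous_reverse [ContinuousNeg V] : Continuous (reverse (V := V) (d := d)) := by
  cases d with
  | zero => exact continuous_of_discreteTopology
  | succ d =>
    rw [continuous_iff]
    have h : ∀ v : {v : Fin (d + 1) → V // LinearIndependent ℝ v},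
        LinearIndependent ℝ (Function.update v.1 0 (-v.1 0)) := fun v => by
      convert v.2.units_smul (Function.update 1 0 (-1)) using 1
      ext i
      by_cases hi : i = 0
      · subst hi
        simp
      · simp [Function.update_of_ne hi]
    have hf : reverse ∘ ofFrame = ofFrame ∘
        fun v : {v : Fin (d + 1) → V // LinearIndependent ℝ v} => ⟨_, h v⟩ :=
      funext fun v => reverse_ofFrame v ⟨_, h v⟩ rfl
    rw [hf]
    refine continuous_ofFrame.comp (Continuous.subtype_mk ?_ _)
    exact continuous_subtype_val.update 0 ((continuous_apply 0).comp continuous_subtype_val).neg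

end Topological

section Hausdorff

variable {V : Type*} [NormedAddCommGroup V] [InnerProductSpace ℝ V] {d : ℕ}

/-- The Plücker coordinates of the oriented span of `v`, normalised to depend only on the oriented
span: the inner product of `v₁ ∧ ⋯ ∧ v_d` with `w₁ ∧ ⋯ ∧ w_d`, divided by the norm of the former. -/
def plucker (v w : Fin d → V) : ℝ :=
  (Matrix.of fun i j => ⟪v i, w j⟫).det / √(Matrix.gram ℝ v).det

/-- The change of frame multiplies the numerator by `det A` and the Gram determinant by `(det A)²`;
the quotient is unchanged when `det A > 0`. -/
theorem plucker_matrix_smul (A : Matrix (Fin d) (Fin d) ℝ) (hA : 0 < A.det) (v v' w : Fin d → V)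
    (hv : ∀ i, v' i = ∑ j, A i j • v j) : plucker v' w = plucker v w := by
  have h1 : ∀ u : Fin d → V, (Matrix.of fun i j => ⟪v' i, u j⟫) =
      A * Matrix.of fun i j => ⟪v i, u j⟫ := by
    intro u
    ext i j
    simp [Matrix.mul_apply, hv, sum_inner, inner_smul_left]
  have h2 : Matrix.gram ℝ v' = A * Matrix.gram ℝ v * A.transpose := by
    ext i j
    simp only [Matrix.gram_apply, Matrix.mul_apply, hv, sum_inner, inner_smul_left, inner_sum,
      inner_smul_right, Matrix.transpose_apply, Finset.sum_mul, Finset.mul_sum]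
    refine Finset.sum_congr rfl fun k _ => Finset.sum_congr rfl fun l _ => ?_
    simp
    ring
  rw [plucker, plucker, h1, h2, Matrix.det_mul, Matrix.det_mul, Matrix.det_mul,
    Matrix.det_transpose, mul_right_comm, Real.sqrt_mul (mul_self_nonneg _),
    Real.sqrt_mul_self hA.le, mul_div_mul_left _ _ hA.ne']

theorem plucker_self_pos {v : Fin d → V} (hv : LinearIndependent ℝ v) : 0 < plucker v v :=
  div_pos (Matrix.posDef_gram_of_linearIndependent hv).det_pos
    (Real.sqrt_pos.2 (Matrix.posDef_gram_of_linearIndependent hv).det_pos)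

theorem plucker_matrix_smul_self (A : Matrix (Fin d) (Fin d) ℝ) (v v' : Fin d → V)
    (hv' : LinearIndependent ℝ v') (hvl : LinearIndependent ℝ v)
    (hv : ∀ i, v' i = ∑ j, A i j • v j) (h : 0 < plucker v' v) : 0 < A.det := by
  have h1 : (Matrix.of fun i j => ⟪v' i, v j⟫) = A * Matrix.gram ℝ v := by
    ext i j
    simp [Matrix.mul_apply, hv, sum_inner, inner_smul_left]
  rw [plucker, h1, Matrix.det_mul] at h
  have h2 := (div_pos_iff_of_pos_right
    (Real.sqrt_pos.2 (Matrix.posDef_gram_of_linearIndependent hv').det_pos)).1 h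
  exact (pos_iff_pos_of_mul_pos h2).2 (Matrix.posDef_gram_of_linearIndependent hvl).det_pos

/-- Recovers the plane from its Plücker coordinates. -/
theorem mem_orthogonal_span_iff {v : Fin d → V} (hv : LinearIndependent ℝ v) (x : V) :
    x ∈ (Submodule.span ℝ (Set.range v))ᗮ ↔
      ∀ j w, plucker v (Function.update w j x) = 0 := by
  have hpos := (Matrix.posDef_gram_of_linearIndependent hv).det_pos
  have hupd : ∀ (j : Fin d) (w : Fin d → V), (Matrix.of fun i k => ⟪v i, Function.update w j x k⟫) =
      (Matrix.of fun i k => ⟪v i, w k⟫).updateCol j (fun i => ⟪v i, x⟫) := by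
    intro j w
    ext i k
    by_cases hk : k = j
    · subst hk
      simp
    · simp [Matrix.updateCol_ne hk, Function.update_of_ne hk]
  constructor
  · intro hx j w
    have h0 : ∀ i, ⟪v i, x⟫ = 0 := fun i =>
      (Submodule.mem_orthogonal _ _).1 hx _ (Submodule.subset_span (Set.mem_range_self i))
    rw [plucker, hupd, Matrix.det_eq_zero_of_column_eq_zero j (by simp [h0]), zero_div]
  · intro h
    have h0 : ∀ i, ⟪v i, x⟫ = 0 := by
      -- With `w = v`, the vanishing numerators are the Cramer determinants of the Gram system with
      -- right side `⟪v i, x⟫`; the Gram matrix being invertible, that right side is zero.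
      have hc : Matrix.cramer (Matrix.gram ℝ v) (fun i => ⟪v i, x⟫) = 0 := by
        ext j
        have := h j v
        rw [plucker, hupd, div_eq_zero_iff] at this
        rw [Matrix.cramer_apply]
        exact this.resolve_right (Real.sqrt_pos.2 hpos).ne'
      have := Matrix.mulVec_cramer (Matrix.gram ℝ v) (fun i => ⟪v i, x⟫)
      rw [hc, Matrix.mulVec_zero] at this
      intro i
      exact (smul_eq_zero.1 (congrFun this.symm i)).resolve_left hpos.ne'
    rw [Submodule.mem_orthogonal]
    intro y hy
    induction hy using Submodule.span_induction with
    | mem _ hy => obtain ⟨i, rfl⟩ := hy; exact h0 i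
    | zero => simp
    | add _ _ _ _ h1 h2 => rw [inner_add_left, h1, h2, add_zero]
    | smul a _ _ h1 => rw [inner_smul_left, h1, mul_zero]

/-- The zeros of `plucker v` determine the plane, and the positivity of `plucker v' v` shows that
the two frames are equally oriented. -/
theorem ofFrame_eq_iff [FiniteDimensional ℝ V]
    (v v' : {v : Fin d → V // LinearIndependent ℝ v}) :
    ofFrame v = ofFrame v' ↔ plucker v.1 = plucker v'.1 := by
  constructor
  · intro h
    obtain ⟨b, hb, hbo⟩ := (eq_ofFrame_iff (ofFrame v) v).1 rfl
    obtain ⟨b', hb', hbo'⟩ := (eq_ofFrame_iff (ofFrame v) v').1 h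
    obtain ⟨A, hA, hdet⟩ := exists_matrix_of_basis b b'
    have hpos := (Module.Basis.orientation_eq_iff_det_pos b b').1 (hbo.trans hbo'.symm)
    ext w
    exact (plucker_matrix_smul A (hdet ▸ hpos) v.1 v'.1 w
      (fun i => by rw [← hb', hA]; simp_rw [hb])).symm
  · intro h
    have hspan : Submodule.span ℝ (Set.range v.1) = Submodule.span ℝ (Set.range v'.1) := by
      rw [← Submodule.orthogonal_orthogonal (Submodule.span ℝ (Set.range v.1)),
        ← Submodule.orthogonal_orthogonal (Submodule.span ℝ (Set.range v'.1))]
      congr 1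
      ext x
      rw [mem_orthogonal_span_iff v.2, mem_orthogonal_span_iff v'.2, h]
    let b : Module.Basis (Fin d) ℝ (ofFrame v).plane := Module.Basis.span v.2
    let b' : Module.Basis (Fin d) ℝ (ofFrame v).plane :=
      (Module.Basis.span v'.2).map (LinearEquiv.ofEq _ _ hspan.symm)
    have hb : ∀ i, (b i : V) = v.1 i := fun i =>
      congrArg Subtype.val (Module.Basis.span_apply v.2 i)
    have hb' : ∀ i, (b' i : V) = v'.1 i := fun i =>
      congrArg Subtype.val (Module.Basis.span_apply v'.2 i)
    obtain ⟨A, hA, hdet⟩ := exists_matrix_of_basis b b'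
    refine (eq_ofFrame_iff _ _).2 ⟨b', hb', ?_⟩
    refine ((Module.Basis.orientation_eq_iff_det_pos b b').2 ?_).symm
    rw [← hdet]
    refine plucker_matrix_smul_self A v.1 v'.1 v'.2 v.2
      (fun i => by rw [← hb', hA]; simp_rw [hb]) ?_
    rw [← h]
    exact plucker_self_pos v.2

instance [FiniteDimensional ℝ V] : T2Space (OrientedGrass V d) := by
  by_cases hd : d = 0
  · subst hd
    infer_instance
  -- `F` uses a chosen frame but is independent of the choice by `ofFrame_eq_iff`; it is a
  -- continuous injection into a Hausdorff function space.
  let F : OrientedGrass V d → (Fin d → V) → ℝ := fun Q =>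
    plucker (Function.surjInv (ofFrame_surjective hd) Q).1
  have hF : ∀ v, F (ofFrame v) = plucker v.1 := fun v =>
    (ofFrame_eq_iff _ _).1 (Function.surjInv_eq (ofFrame_surjective hd) (ofFrame v))
  refine T2Space.of_injective_continuous (f := F) (fun Q Q' h => ?_) ?_
  · obtain ⟨v, rfl⟩ := ofFrame_surjective hd Q
    obtain ⟨v', rfl⟩ := ofFrame_surjective hd Q'
    rw [hF, hF] at h
    exact (ofFrame_eq_iff v v').2 h
  · rw [continuous_iff]
    have : F ∘ ofFrame = fun v => plucker v.1 := funext hF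
    rw [this]
    refine continuous_pi fun w => ?_
    unfold plucker
    refine Continuous.div ?_ ?_ fun v =>
      (Real.sqrt_pos.2 (Matrix.posDef_gram_of_linearIndependent v.2).det_pos).ne'
    · refine Continuous.matrix_det (continuous_matrix fun i j => ?_)
      exact ((continuous_apply i).comp continuous_subtype_val).inner continuous_const
    · refine Real.continuous_sqrt.comp (Continuous.matrix_det (continuous_matrix fun i j => ?_))
      exact ((continuous_apply i).comp continuous_subtype_val).inner
        ((continuous_apply j).comp continuous_subtype_val)

end Hausdorff

end OrientedGrass

/-! ### Orientations induced by complex structures -/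

/-- The bijection listing the pairs `(a, 0), (a, 1)` in lexicographic order. -/
def pairIndex {ι : Type*} {k : ℕ} (ε : ι ≃ Fin k) : ι × Fin 2 ≃ Fin (2 * k) :=
  ((ε.prodCongr (Equiv.refl _)).trans finProdFinEquiv).trans (finCongr (mul_comm k 2))

theorem pairIndex_zero {ι : Type*} {k : ℕ} (ε : ι ≃ Fin k) (a : ι) :
    pairIndex ε (a, 0) = ⟨2 * ε a, by omega⟩ :=
  Fin.ext (by simp [pairIndex])

theorem pairIndex_one {ι : Type*} {k : ℕ} (ε : ι ≃ Fin k) (a : ι) :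
    pairIndex ε (a, 1) = ⟨2 * ε a + 1, by omega⟩ :=
  Fin.ext (by simp [pairIndex, add_comm])

/-- `T` is linear for the `ℂ`-structure defined by `J`, and its real determinant is the squared
modulus of its complex one. -/
theorem det_pos_of_commute_complexStructure {E : Type*} [AddCommGroup E] [Module ℝ E]
    [FiniteDimensional ℝ E] {J : E →ₗ[ℝ] E} (hJ : ∀ x, J (J x) = -x) (T : E ≃ₗ[ℝ] E)
    (hT : ∀ x, T (J x) = J (T x)) : 0 < LinearMap.det (T : E →ₗ[ℝ] E) := by
  let f : ℂ →ₐ[ℝ] Module.End ℝ E := Complex.lift ⟨J, LinearMap.ext hJ⟩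
  let _ : Module ℂ E := Module.compHom E f.toRingHom
  have hsmul : ∀ (z : ℂ) (x : E), z • x = z.re • x + z.im • J x := fun z x => by
    change f z x = _
    simp [f, Complex.liftAux_apply, Algebra.algebraMap_eq_smul_one]
  have : IsScalarTower ℝ ℂ E := ⟨fun a z x => by simp [hsmul, mul_smul, smul_add]⟩
  have : FiniteDimensional ℂ E := FiniteDimensional.right ℝ ℂ E
  let T' : E →ₗ[ℂ] E :=
    { toFun := T
      map_add' := T.map_add
      map_smul' := fun z x => by simp [hsmul, hT] }
  have h : (T : E →ₗ[ℝ] E) = T'.restrictScalars ℝ := rfl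
  have h0 : LinearMap.det (T : E →ₗ[ℝ] E) ≠ 0 := (LinearEquiv.isUnit_det' T).ne_zero
  rw [h, LinearMap.det_restrictScalars, Algebra.norm_complex_apply] at h0 ⊢
  exact lt_of_le_of_ne (Complex.normSq_nonneg _) h0.symm

section

variable {V : Type*} [NormedAddCommGroup V] [InnerProductSpace ℝ V]

theorem mem_of_basis_complexStructure {J : V →ₗ[ℝ] V} (hJ : ∀ x, J (J x) = -x) {k : ℕ}
    {P : Submodule ℝ V} (b : Module.Basis (Fin (2 * k)) ℝ P)
    (hb : ∀ a : Fin k, (b ⟨2 * a + 1, by omega⟩ : V) = J (b ⟨2 * a, by omega⟩ : V)) :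
    ∀ x ∈ P, J x ∈ P := by
  intro x hx
  have h : (⊤ : Submodule ℝ P) ≤ P.comap (J ∘ₗ P.subtype) := by
    rw [← b.span_eq, Submodule.span_le]
    rintro _ ⟨n, rfl⟩
    change J (b n : V) ∈ P
    obtain ⟨⟨a, e⟩, rfl⟩ := (pairIndex (Equiv.refl (Fin k))).surjective n
    obtain rfl | rfl : e = 0 ∨ e = 1 := by omega
    · rw [pairIndex_zero, ← hb]
      exact Submodule.coe_mem _
    · rw [pairIndex_one, hb, hJ]
      exact P.neg_mem (Submodule.coe_mem _)
  exact h (Submodule.mem_top (x := (⟨x, hx⟩ : P)))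

/-- A basis of pairs `(v, J v)` induces the orientation. -/
theorem inducesOrientation_of_basis {J : V →ₗ[ℝ] V} {ι : Type*} {k : ℕ} (ε : ι ≃ Fin k)
    {P : Submodule ℝ V} (b : Module.Basis (ι × Fin 2) ℝ P)
    (hb : ∀ a, (b (a, 1) : V) = J (b (a, 0) : V)) :
    InducesOrientation J P (b.reindex (pairIndex ε)).orientation := by
  refine ⟨b.reindex (pairIndex ε), fun a => ?_, rfl⟩
  have h0 := pairIndex_zero ε (ε.symm a)
  have h1 := pairIndex_one ε (ε.symm a)
  simp only [Equiv.apply_symm_apply] at h0 h1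
  rw [← h0, ← h1]
  simpa using hb (ε.symm a)

/-- The map matching two bases of pairs `(v, J v)` commutes with `J`, so its determinant is
positive. -/
theorem InducesOrientation.unique [FiniteDimensional ℝ V] {J : V →ₗ[ℝ] V}
    (hJ : ∀ x, J (J x) = -x) {k : ℕ} {P : Submodule ℝ V}
    {o o' : Orientation ℝ P (Fin (2 * k))} (h : InducesOrientation J P o)
    (h' : InducesOrientation J P o') : o = o' := by
  obtain ⟨b, hb, rfl⟩ := h
  obtain ⟨b', hb', rfl⟩ := h'
  let JP : P →ₗ[ℝ] P := J.restrict (mem_of_basis_complexStructure hJ b hb)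
  have hJP : ∀ x, JP (JP x) = -x := fun x => Subtype.ext (hJ x)
  let T := b.equiv b' (Equiv.refl _)
  have hmap : b.map T = b' := Module.Basis.eq_of_apply_eq fun i => by simp [T]
  have hT : ∀ x, T (JP x) = JP (T x) := by
    have : T.toLinearMap ∘ₗ JP = JP ∘ₗ T.toLinearMap := by
      refine b.ext fun n => ?_
      have hTb : ∀ n, T (b n) = b' n := fun n => by simp [T]
      have hbJ : ∀ a : Fin k, b ⟨2 * a + 1, by omega⟩ = JP (b ⟨2 * a, by omega⟩) :=
        fun a => Subtype.ext (hb a)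
      have hbJ' : ∀ a : Fin k, b' ⟨2 * a + 1, by omega⟩ = JP (b' ⟨2 * a, by omega⟩) :=
        fun a => Subtype.ext (hb' a)
      change T (JP (b n)) = JP (T (b n))
      obtain ⟨⟨a, e⟩, rfl⟩ := (pairIndex (Equiv.refl (Fin k))).surjective n
      obtain rfl | rfl : e = 0 ∨ e = 1 := by omega
      · rw [pairIndex_zero, ← hbJ, hTb, hTb, hbJ']
      · rw [pairIndex_one, hTb, hbJ, hbJ', hJP, hJP, map_neg, hTb]
    exact fun x => LinearMap.congr_fun this x
  rw [← hmap]
  exact ((b.orientation_comp_linearEquiv_eq_iff_det_pos T).2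
    (det_pos_of_commute_complexStructure hJP T hT)).symm

end

/-! ### Summands and multiplication operators of the model space -/

section Model

variable {m : ℕ} {r : Fin m → ℕ} {l s : ℕ}

theorem ModelSpace.ext {x y : ModelSpace r l s} (h₁ : ∀ i, x.fst i = y.fst i)
    (h₂ : x.snd.fst = y.snd.fst) (h₃ : x.snd.snd = y.snd.snd) : x = y := by
  refine (WithLp.ext_iff _).2 (Prod.ext (PiLp.ext h₁) ((WithLp.ext_iff _).2 (Prod.ext h₂ h₃)))

/-- The inclusion of `ℍ^{r i}` into the model space. -/
def embedQuaternion (r : Fin m → ℕ) (l s : ℕ) (i : Fin m) :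
    QuaternionSpace (r i) →ₗ[ℝ] ModelSpace r l s where
  toFun y := WithLp.toLp 2 (WithLp.toLp 2 (Pi.single i y), 0)
  map_add' x y := by
    refine ModelSpace.ext (fun j => ?_) (by simp) (by simp)
    simp [Pi.single_add]
  map_smul' a x := by
    refine ModelSpace.ext (fun j => ?_) (by simp) (by simp)
    simp [Pi.single_smul]

/-- The inclusion of `ℂ^ℓ` into the model space. -/
def embedComplex (r : Fin m → ℕ) (l s : ℕ) : ComplexSpace l →ₗ[ℝ] ModelSpace r l s where
  toFun y := WithLp.toLp 2 (0, WithLp.toLp 2 (y, 0))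
  map_add' x y := ModelSpace.ext (fun j => by simp) (by simp) (by simp)
  map_smul' a x := ModelSpace.ext (fun j => by simp) (by simp) (by simp)

/-- The inclusion of `ℂ^s` into the model space. -/
def embedConj (r : Fin m → ℕ) (l s : ℕ) : ComplexSpace s →ₗ[ℝ] ModelSpace r l s where
  toFun y := WithLp.toLp 2 (0, WithLp.toLp 2 (0, y))
  map_add' x y := ModelSpace.ext (fun j => by simp) (by simp) (by simp)
  map_smul' a x := ModelSpace.ext (fun j => by simp) (by simp) (by simp)

@[simp] theorem embedQuaternion_fst (i j : Fin m) (y : QuaternionSpace (r i)) :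
    (embedQuaternion r l s i y).fst j = Pi.single (M := fun i => QuaternionSpace (r i)) i y j := rfl
@[simp] theorem embedQuaternion_snd (i : Fin m) (y : QuaternionSpace (r i)) :
    (embedQuaternion r l s i y).snd = 0 := rfl
@[simp] theorem embedComplex_fst (y : ComplexSpace l) : (embedComplex r l s y).fst = 0 := rfl
@[simp] theorem embedComplex_snd_fst (y : ComplexSpace l) :
    (embedComplex r l s y).snd.fst = y := rfl
@[simp] theorem embedComplex_snd_snd (y : ComplexSpace l) :
    (embedComplex r l s y).snd.snd = 0 := rfl
@[simp] theorem embedConj_fst (y : ComplexSpace s) : (embedConj r l s y).fst = 0 := rfl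
@[simp] theorem embedConj_snd_fst (y : ComplexSpace s) : (embedConj r l s y).snd.fst = 0 := rfl
@[simp] theorem embedConj_snd_snd (y : ComplexSpace s) : (embedConj r l s y).snd.snd = y := rfl

theorem sum_embed (x : ModelSpace r l s) :
    ∑ i, embedQuaternion r l s i (x.fst i) + embedComplex r l s x.snd.fst +
      embedConj r l s x.snd.snd = x := by
  have h1 : (∑ i, embedQuaternion r l s i (x.fst i)).fst = x.fst := by
    refine (map_sum (WithLp.fstₗ 2 ℝ _ _) _ _).trans (PiLp.ext fun j => ?_)
    refine (map_sum (PiLp.projₗ (𝕜 := ℝ) 2 (fun i : Fin m => QuaternionSpace (r i)) j) _ _).trans ?_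
    refine (Finset.sum_eq_single j (fun i _ hij => ?_) (by simp)).trans ?_
    · exact Pi.single_eq_of_ne hij.symm _
    · exact Pi.single_eq_same _ _
  have h2 : (∑ i, embedQuaternion r l s i (x.fst i)).snd = 0 :=
    (map_sum (WithLp.sndₗ 2 ℝ _ _) _ _).trans (Finset.sum_eq_zero fun i _ => rfl)
  exact ModelSpace.ext (by simp [h1]) (by simp [h2]) (by simp [h2])

@[simp] theorem modelMul_fst (α : Fin m → ℍ[ℝ]) (β γ : ℂ) (x : ModelSpace r l s) (i : Fin m) :
    (modelMul r l s α β γ x).fst i = α i • x.fst i := rfl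
@[simp] theorem modelMul_snd_fst (α : Fin m → ℍ[ℝ]) (β γ : ℂ) (x : ModelSpace r l s) :
    (modelMul r l s α β γ x).snd.fst = β • x.snd.fst := rfl
@[simp] theorem modelMul_snd_snd (α : Fin m → ℍ[ℝ]) (β γ : ℂ) (x : ModelSpace r l s) :
    (modelMul r l s α β γ x).snd.snd = γ • x.snd.snd := rfl

theorem modelMul_embedQuaternion (α : Fin m → ℍ[ℝ]) (β γ : ℂ) (i : Fin m)
    (y : QuaternionSpace (r i)) :
    modelMul r l s α β γ (embedQuaternion r l s i y) = embedQuaternion r l s i (α i • y) := by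
  refine ModelSpace.ext (fun j => ?_) (by simp) (by simp)
  by_cases h : j = i
  · subst h; simp
  · simp [Pi.single_eq_of_ne h]

theorem modelMul_embedComplex (α : Fin m → ℍ[ℝ]) (β γ : ℂ) (y : ComplexSpace l) :
    modelMul r l s α β γ (embedComplex r l s y) = embedComplex r l s (β • y) :=
  ModelSpace.ext (by simp) (by simp) (by simp)

theorem modelMul_embedConj (α : Fin m → ℍ[ℝ]) (β γ : ℂ) (y : ComplexSpace s) :
    modelMul r l s α β γ (embedConj r l s y) = embedConj r l s (γ • y) :=
  ModelSpace.ext (by simp) (by simp) (by simp)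

/-- With the two lemmas that follow, this reduces identities between operators to identities between
their scalars. -/
theorem modelMul_modelMul (α α' : Fin m → ℍ[ℝ]) (β β' γ γ' : ℂ) (x : ModelSpace r l s) :
    modelMul r l s α β γ (modelMul r l s α' β' γ' x) =
      modelMul r l s (α * α') (β * β') (γ * γ') x :=
  ModelSpace.ext (by simp [mul_smul]) (by simp [mul_smul]) (by simp [mul_smul])

theorem modelMul_add (α α' : Fin m → ℍ[ℝ]) (β β' γ γ' : ℂ) (x : ModelSpace r l s) :
    modelMul r l s (α + α') (β + β') (γ + γ') x =
      modelMul r l s α β γ x + modelMul r l s α' β' γ' x :=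
  ModelSpace.ext (by simp [add_smul]) (by simp [add_smul]) (by simp [add_smul])

theorem modelMul_real_smul (a : ℝ) (α : Fin m → ℍ[ℝ]) (β γ : ℂ) (x : ModelSpace r l s) :
    modelMul r l s (a • α) (a • β) (a • γ) x = a • modelMul r l s α β γ x :=
  ModelSpace.ext (by simp) (smul_assoc a β _) (smul_assoc a γ _)

end Model

/-! ### Splitting a stable plane along the summands -/

section Decomposition

variable {m : ℕ} {θ : Fin m → ℝ} {r : Fin m → ℕ} {l s : ℕ}

theorem Stabilises.map_mem {V : Type*} [NormedAddCommGroup V] [InnerProductSpace ℝ V]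
    {J : V →ₗ[ℝ] V} {P : Submodule ℝ V} (h : Stabilises J P) {x : V} (hx : x ∈ P) : J x ∈ P := by
  unfold Stabilises at h
  rw [← h]
  exact Submodule.mem_map_of_mem hx

@[simp] theorem quaternionI_re : quaternionI.re = 0 := rfl
@[simp] theorem quaternionI_imI : quaternionI.imI = 1 := rfl
@[simp] theorem quaternionI_imJ : quaternionI.imJ = 0 := rfl
@[simp] theorem quaternionI_imK : quaternionI.imK = 0 := rfl
@[simp] theorem quaternionRot_re (t : ℝ) : (quaternionRot t).re = 0 := rfl
@[simp] theorem quaternionRot_imI (t : ℝ) : (quaternionRot t).imI = Real.cos t := rfl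
@[simp] theorem quaternionRot_imJ (t : ℝ) : (quaternionRot t).imJ = 0 := rfl
@[simp] theorem quaternionRot_imK (t : ℝ) : (quaternionRot t).imK = Real.sin t := rfl

theorem quaternionI_mul_self : quaternionI * quaternionI = -1 := by
  ext <;> simp

theorem quaternionRot_mul_self (t : ℝ) : quaternionRot t * quaternionRot t = -1 := by
  ext <;> simp
  · linarith [Real.sin_sq_add_cos_sq t]
  · ring

theorem anticommutator_quaternionRot (t : ℝ) :
    quaternionI * quaternionRot t + quaternionRot t * quaternionI =
      ((-2 * Real.cos t : ℝ) : ℍ[ℝ]) := by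
  ext <;> simp
  ring

/-- This operator is `-(J₀J₁ + J₁J₀)/2`; the anticommutator of `i` and `ie^{jθ}` is the real number
`-2 cos θ`. -/
theorem modelMul_cos_mem {P : Submodule ℝ (ModelSpace r l s)}
    (h₀ : Stabilises (modelJ₀ r l s) P) (h₁ : Stabilises (modelJ₁ θ r l s) P)
    {x : ModelSpace r l s} (hx : x ∈ P) :
    modelMul r l s (fun i => (Real.cos (θ i) : ℍ[ℝ])) 1 (-1) x ∈ P := by
  have h : modelMul r l s (fun i => (Real.cos (θ i) : ℍ[ℝ])) 1 (-1) x = (-(1 / 2) : ℝ) •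
      (modelJ₀ r l s (modelJ₁ θ r l s x) + modelJ₁ θ r l s (modelJ₀ r l s x)) := by
    rw [modelJ₀, modelJ₁, modelMul_modelMul, modelMul_modelMul, ← modelMul_add,
      ← modelMul_real_smul]
    congr 2
    · ext1 i
      simp only [Pi.smul_apply, Pi.add_apply, Pi.mul_apply, anticommutator_quaternionRot]
      ext <;> simp
    · rw [Complex.I_mul_I]
      norm_num
    · simp
      norm_num
  rw [h]
  exact P.smul_mem _ (P.add_mem (h₀.map_mem (h₁.map_mem hx)) (h₁.map_mem (h₀.map_mem hx)))

theorem modelMul_eval_cos_mem {P : Submodule ℝ (ModelSpace r l s)}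
    (h₀ : Stabilises (modelJ₀ r l s) P) (h₁ : Stabilises (modelJ₁ θ r l s) P)
    (p : Polynomial ℝ) {x : ModelSpace r l s} (hx : x ∈ P) :
    modelMul r l s (fun i => ((p.eval (Real.cos (θ i)) : ℝ) : ℍ[ℝ])) (p.eval 1 : ℝ)
      (p.eval (-1) : ℝ) x      ∈ P := by
  induction p using Polynomial.induction_on generalizing x with
  | C a =>
    convert P.smul_mem a hx using 1
    refine ModelSpace.ext (fun i => ?_) ?_ ?_
    · simp only [Polynomial.eval_C]
      exact algebraMap_smul ℍ[ℝ] a (x.fst i)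
    · ext; simp
    · ext; simp
  | add p q hp hq =>
    convert P.add_mem (hp hx) (hq hx) using 1
    rw [← modelMul_add]
    congr 2
    · ext1 i
      simp
    · simp
    · simp
  | monomial n a h =>
    convert modelMul_cos_mem h₀ h₁ (h hx) using 1
    rw [modelMul_modelMul]
    congr 2
    · ext1 i
      simp only [Pi.mul_apply, ← Quaternion.coe_mul]
      congr 1
      simp
      ring
    · simp
    · simp [pow_succ]

/-- Lagrange interpolation at the distinct nodes `cos θ_i`, `1`, `-1` makes every choice of one real
scalar per summand a polynomial in the cosine operator. -/
theorem modelMul_real_mem (hθ : StrictMono θ) (hθ_pos : ∀ i, 0 < θ i) (hθ_lt : ∀ i, θ i < Real.pi)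
    {P : Submodule ℝ (ModelSpace r l s)}
    (h₀ : Stabilises (modelJ₀ r l s) P) (h₁ : Stabilises (modelJ₁ θ r l s) P)
    (f : Fin m → ℝ) (a b : ℝ) {x : ModelSpace r l s} (hx : x ∈ P) :
    modelMul r l s (fun i => (f i : ℍ[ℝ])) (a : ℝ) (b : ℝ) x ∈ P := by
  -- The summands `ℂ` and `ℂ̄` count as the angles `0` and `π`, so that injectivity of `cos` on `[0,
  -- π]` separates all nodes.
  let ϑ : Fin m ⊕ Bool → ℝ := Sum.elim θ fun c => if c then 0 else Real.pi
  have hϑ : Function.Injective (Real.cos ∘ ϑ) := by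
    have hmem : ∀ c, ϑ c ∈ Set.Icc 0 Real.pi := by
      rintro (i | _ | _)
      · exact ⟨(hθ_pos i).le, (hθ_lt i).le⟩
      · simp [ϑ, Real.pi_pos.le]
      · simp [ϑ, Real.pi_pos.le]
    have hinj : Function.Injective ϑ := by
      rintro (i | _ | _) (j | _ | _) h
      all_goals simp [ϑ, hθ.injective.eq_iff, Real.pi_ne_zero, Real.pi_ne_zero.symm] at h ⊢
      · exact h
      · exact (hθ_lt i).ne h
      · exact (hθ_pos i).ne' h
      · exact (hθ_lt j).ne' h
      · exact (hθ_pos j).ne h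
    exact fun c d h => hinj (Real.injOn_cos (hmem c) (hmem d) h)
  let F : Fin m ⊕ Bool → ℝ := Sum.elim f fun c => if c then a else b
  let p := Lagrange.interpolate Finset.univ (Real.cos ∘ ϑ) F
  have hp : ∀ c, p.eval (Real.cos (ϑ c)) = F c := fun c =>
    Lagrange.eval_interpolate_at_node F hϑ.injOn (Finset.mem_univ c)
  have h1 : ∀ i, p.eval (Real.cos (θ i)) = f i := fun i => hp (Sum.inl i)
  have h2 : p.eval 1 = a := by simpa [ϑ, F] using hp (Sum.inr true)
  have h3 : p.eval (-1) = b := by simpa [ϑ, F] using hp (Sum.inr false)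
  have := modelMul_eval_cos_mem h₀ h₁ p hx
  simpa only [h1, h2, h3] using this

theorem embedQuaternion_mem (hθ : StrictMono θ) (hθ_pos : ∀ i, 0 < θ i)
    (hθ_lt : ∀ i, θ i < Real.pi) {P : Submodule ℝ (ModelSpace r l s)}
    (h₀ : Stabilises (modelJ₀ r l s) P) (h₁ : Stabilises (modelJ₁ θ r l s) P)
    {x : ModelSpace r l s} (hx : x ∈ P) (i : Fin m) : embedQuaternion r l s i (x.fst i) ∈ P := by
  convert modelMul_real_mem hθ hθ_pos hθ_lt h₀ h₁ (Pi.single i 1) 0 0 hx using 1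
  refine ModelSpace.ext (fun j => ?_) (by simp) (by simp)
  by_cases h : j = i
  · subst h; simp
  · simp [Pi.single_eq_of_ne h]

theorem embedComplex_mem (hθ : StrictMono θ) (hθ_pos : ∀ i, 0 < θ i)
    (hθ_lt : ∀ i, θ i < Real.pi) {P : Submodule ℝ (ModelSpace r l s)}
    (h₀ : Stabilises (modelJ₀ r l s) P) (h₁ : Stabilises (modelJ₁ θ r l s) P)
    {x : ModelSpace r l s} (hx : x ∈ P) : embedComplex r l s x.snd.fst ∈ P := by
  convert modelMul_real_mem hθ hθ_pos hθ_lt h₀ h₁ 0 1 0 hx using 1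
  exact ModelSpace.ext (by simp) (by simp) (by simp)

theorem embedConj_mem (hθ : StrictMono θ) (hθ_pos : ∀ i, 0 < θ i)
    (hθ_lt : ∀ i, θ i < Real.pi) {P : Submodule ℝ (ModelSpace r l s)}
    (h₀ : Stabilises (modelJ₀ r l s) P) (h₁ : Stabilises (modelJ₁ θ r l s) P)
    {x : ModelSpace r l s} (hx : x ∈ P) : embedConj r l s x.snd.snd ∈ P := by
  convert modelMul_real_mem hθ hθ_pos hθ_lt h₀ h₁ 0 0 1 hx using 1
  exact ModelSpace.ext (by simp) (by simp) (by simp)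

/-- For `sin t ≠ 0` the quaternions `1`, `i`, `ie^{jt}` and `i · ie^{jt} = -cos t - sin t j` form a
real basis of `ℍ`. -/
theorem quaternion_eq_combination {t : ℝ} (ht : Real.sin t ≠ 0) (q : ℍ[ℝ]) :
    q = (q.re - q.imJ * Real.cos t / Real.sin t) • (1 : ℍ[ℝ]) +
      (q.imI - q.imK * Real.cos t / Real.sin t) • quaternionI +
      (q.imK / Real.sin t) • quaternionRot t +
      (-(q.imJ / Real.sin t)) • (quaternionI * quaternionRot t) := by
  ext <;> simp <;> field_simp <;> ring

/-- The `i`-th component of a subspace stable under both complex structures. -/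
def quaternionComponent (hθ_pos : ∀ i, 0 < θ i) (hθ_lt : ∀ i, θ i < Real.pi)
    {P : Submodule ℝ (ModelSpace r l s)} (h₀ : Stabilises (modelJ₀ r l s) P)
    (h₁ : Stabilises (modelJ₁ θ r l s) P) (i : Fin m) :
    Submodule ℍ[ℝ] (QuaternionSpace (r i)) where
  __ := P.comap (embedQuaternion r l s i)
  smul_mem' q y hy := by
    change embedQuaternion r l s i y ∈ P at hy
    change embedQuaternion r l s i (q • y) ∈ P
    have hI : ∀ {y}, embedQuaternion r l s i y ∈ P →
        embedQuaternion r l s i (quaternionI • y) ∈ P := fun {y} hy => by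
      have := h₀.map_mem hy
      rwa [modelJ₀, modelMul_embedQuaternion] at this
    have hR : embedQuaternion r l s i (quaternionRot (θ i) • y) ∈ P := by
      have := h₁.map_mem hy
      rwa [modelJ₁, modelMul_embedQuaternion] at this
    have ht := (Real.sin_pos_of_pos_of_lt_pi (hθ_pos i) (hθ_lt i)).ne'
    rw [quaternion_eq_combination ht q]
    simp only [add_smul, map_add, smul_assoc, map_smul, one_smul, mul_smul]
    exact P.add_mem (P.add_mem (P.add_mem (P.smul_mem _ hy) (P.smul_mem _ (hI hy)))
      (P.smul_mem _ hR)) (P.smul_mem _ (hI hR))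

theorem complex_smul_eq {M : Type*} [AddCommGroup M] [Module ℂ M] [Module ℝ M]
    [IsScalarTower ℝ ℂ M] (z : ℂ) (y : M) : z • y = z.re • y + z.im • (Complex.I • y) := by
  conv_lhs => rw [← Complex.re_add_im z]
  rw [add_smul, mul_smul]
  exact congrArg₂ _ (algebraMap_smul ℂ z.re y) (algebraMap_smul ℂ z.im (Complex.I • y))

/-- The component in `ℂ^ℓ` of a subspace stable under the first complex structure. -/
def complexComponent {P : Submodule ℝ (ModelSpace r l s)} (h₀ : Stabilises (modelJ₀ r l s) P) :
    Submodule ℂ (ComplexSpace l) where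
  __ := P.comap (embedComplex r l s)
  smul_mem' z y hy := by
    change embedComplex r l s y ∈ P at hy
    change embedComplex r l s (z • y) ∈ P
    have := h₀.map_mem hy
    rw [modelJ₀, modelMul_embedComplex] at this
    rw [complex_smul_eq, map_add, map_smul, map_smul]
    exact P.add_mem (P.smul_mem _ hy) (P.smul_mem _ this)

/-- The component in `ℂ^s` of a subspace stable under the first complex structure. -/
def conjComponent {P : Submodule ℝ (ModelSpace r l s)} (h₀ : Stabilises (modelJ₀ r l s) P) :
    Submodule ℂ (ComplexSpace s) where
  __ := P.comap (embedConj r l s)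
  smul_mem' z y hy := by
    change embedConj r l s y ∈ P at hy
    change embedConj r l s (z • y) ∈ P
    have := h₀.map_mem hy
    rw [modelJ₀, modelMul_embedConj] at this
    rw [complex_smul_eq, map_add, map_smul, map_smul]
    exact P.add_mem (P.smul_mem _ hy) (P.smul_mem _ this)

end Decomposition

/-! ### Stable planes of the model correspond to points of the disjoint union -/

section DirectSum

variable {m : ℕ} {r : Fin m → ℕ} {l s k : ℕ} {c : PieceIndex r l s k}

theorem Piece.mem_directSum {p : Piece r l s k c} {x : ModelSpace r l s} :
    x ∈ p.directSum ↔ (∀ i, x.fst i ∈ (p.1 i).plane) ∧ x.snd.fst ∈ p.2.1.plane ∧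
      x.snd.snd ∈ p.2.2.plane := Iff.rfl

theorem Piece.embedQuaternion_mem_iff {p : Piece r l s k c} {i : Fin m}
    {y : QuaternionSpace (r i)} :
    embedQuaternion r l s i y ∈ p.directSum ↔ y ∈ (p.1 i).plane := by
  rw [mem_directSum]
  constructor
  · intro h
    simpa using h.1 i
  · intro h
    refine ⟨fun j => ?_, by simp, by simp⟩
    by_cases hj : j = i
    · subst hj; simpa using h
    · simp [Pi.single_eq_of_ne hj]

theorem Piece.embedComplex_mem_iff {p : Piece r l s k c} {y : ComplexSpace l} :
    embedComplex r l s y ∈ p.directSum ↔ y ∈ p.2.1.plane := by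
  simp [mem_directSum]

theorem Piece.embedConj_mem_iff {p : Piece r l s k c} {y : ComplexSpace s} :
    embedConj r l s y ∈ p.directSum ↔ y ∈ p.2.2.plane := by
  simp [mem_directSum]

/-- Intersecting with the summands recovers the planes, and their dimensions recover the index. -/
theorem PieceUnion.directSum_injective :
    Function.Injective (fun x : PieceUnion r l s k => x.2.directSum) := by
  rintro ⟨c, p⟩ ⟨c', p'⟩ h
  dsimp only at h
  have h1 : ∀ i, (p.1 i).plane = (p'.1 i).plane := fun i => by
    ext y
    rw [← Piece.embedQuaternion_mem_iff, ← Piece.embedQuaternion_mem_iff, h]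
  have h2 : p.2.1.plane = p'.2.1.plane := by
    ext y
    rw [← Piece.embedComplex_mem_iff, ← Piece.embedComplex_mem_iff, h]
  have h3 : p.2.2.plane = p'.2.2.plane := by
    ext y
    rw [← Piece.embedConj_mem_iff, ← Piece.embedConj_mem_iff, h]
  obtain ⟨t, l', s', _, _, _, _⟩ := c
  obtain ⟨t', l'', s'', _, _, _, _⟩ := c'
  obtain rfl : t = t' := funext fun i =>
    (p.1 i).finrank_eq.symm.trans ((congrArg (fun Q : Submodule ℍ[ℝ] _ => Module.finrank ℍ[ℝ] Q) (h1 i)).trans (p'.1 i).finrank_eq)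
  obtain rfl : l' = l'' :=
    p.2.1.finrank_eq.symm.trans ((congrArg (fun Q : Submodule ℂ _ => Module.finrank ℂ Q) h2).trans p'.2.1.finrank_eq)
  obtain rfl : s' = s'' :=
    p.2.2.finrank_eq.symm.trans ((congrArg (fun Q : Submodule ℂ _ => Module.finrank ℂ Q) h3).trans p'.2.2.finrank_eq)
  congr 1
  exact Prod.ext (funext fun i => Grass.plane_injective (h1 i))
    (Prod.ext (Grass.plane_injective h2) (Grass.plane_injective h3))

theorem Piece.finrank_directSum (p : Piece r l s k c) : Module.finrank ℝ p.directSum = 2 * k := by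
  let e : p.directSum ≃ₗ[ℝ] (∀ i, (p.1 i).plane) × p.2.1.plane × p.2.2.plane :=
    { toFun := fun x => (fun i => ⟨x.1.fst i, x.2.1 i⟩, ⟨x.1.snd.fst, x.2.2.1⟩,
        ⟨x.1.snd.snd, x.2.2.2⟩)
      invFun := fun y => ⟨WithLp.toLp 2 (WithLp.toLp 2 (fun i => (y.1 i : QuaternionSpace (r i))),
        WithLp.toLp 2 (y.2.1.1, y.2.2.1)), fun i => (y.1 i).2, y.2.1.2, y.2.2.2⟩
      map_add' := fun _ _ => rfl
      map_smul' := fun _ _ => rfl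
      left_inv := fun _ => rfl
      right_inv := fun _ => rfl }
  have : ∀ i, Module.Finite ℝ (p.1 i).plane := fun i => Module.Finite.trans ℍ[ℝ] _
  have : Module.Finite ℝ p.2.1.plane := Module.Finite.trans ℂ _
  have : Module.Finite ℝ p.2.2.plane := Module.Finite.trans ℂ _
  have h1 : ∀ i, Module.finrank ℝ (p.1 i).plane = 4 * c.t i := fun i => by
    rw [← Module.finrank_mul_finrank ℝ ℍ[ℝ] (p.1 i).plane, Quaternion.finrank_eq_four,
      (p.1 i).finrank_eq]
  have h2 : Module.finrank ℝ p.2.1.plane = 2 * c.l' := by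
    rw [← Module.finrank_mul_finrank ℝ ℂ p.2.1.plane, Complex.finrank_real_complex,
      p.2.1.finrank_eq]
  have h3 : Module.finrank ℝ p.2.2.plane = 2 * c.s' := by
    rw [← Module.finrank_mul_finrank ℝ ℂ p.2.2.plane, Complex.finrank_real_complex,
      p.2.2.finrank_eq]
  rw [e.finrank_eq, Module.finrank_prod, Module.finrank_prod, Module.finrank_pi_fintype]
  simp only [h1, h2, h3]
  rw [← Finset.mul_sum]
  have := c.sum_eq
  omega

theorem stabilises_of_sq {V : Type*} [NormedAddCommGroup V] [InnerProductSpace ℝ V]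
    {J : V →ₗ[ℝ] V} {P : Submodule ℝ V} (hJ : ∀ x, J (J x) = -x) (h : ∀ x ∈ P, J x ∈ P) :
    Stabilises J P := by
  refine le_antisymm (Submodule.map_le_iff_le_comap.2 h) fun x hx => ?_
  exact ⟨-J x, P.neg_mem (h x hx), by rw [map_neg, hJ, neg_neg]⟩

theorem modelMul_sq_neg {α : Fin m → ℍ[ℝ]} {β γ : ℂ} (hα : ∀ i, α i * α i = -1)
    (hβ : β * β = -1) (hγ : γ * γ = -1) (x : ModelSpace r l s) :
    modelMul r l s α β γ (modelMul r l s α β γ x) = -x := by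
  rw [modelMul_modelMul, hβ, hγ, show α * α = -1 from funext hα]
  exact ModelSpace.ext (by simp) (by simp) (by simp)

theorem Piece.modelMul_mem (p : Piece r l s k c) (α : Fin m → ℍ[ℝ]) (β γ : ℂ)
    {x : ModelSpace r l s} (hx : x ∈ p.directSum) : modelMul r l s α β γ x ∈ p.directSum :=
  ⟨fun i => (p.1 i).plane.smul_mem (α i) (hx.1 i), p.2.1.plane.smul_mem β hx.2.1,
    p.2.2.plane.smul_mem γ hx.2.2⟩

theorem Piece.stabilises_modelJ₀ (p : Piece r l s k c) :
    Stabilises (modelJ₀ r l s) p.directSum :=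
  stabilises_of_sq (fun x => modelMul_sq_neg (fun _ => quaternionI_mul_self) (by simp) (by simp) x)
    fun _ hx => p.modelMul_mem _ _ _ hx

theorem Piece.stabilises_modelJ₁ (θ : Fin m → ℝ) (p : Piece r l s k c) :
    Stabilises (modelJ₁ θ r l s) p.directSum :=
  stabilises_of_sq (fun x => modelMul_sq_neg (fun i => quaternionRot_mul_self (θ i)) (by simp)
    (by simp) x) fun _ hx => p.modelMul_mem _ _ _ hx

theorem exists_directSum_eq {θ : Fin m → ℝ} (hθ : StrictMono θ) (hθ_pos : ∀ i, 0 < θ i)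
    (hθ_lt : ∀ i, θ i < Real.pi) {P : Submodule ℝ (ModelSpace r l s)}
    (h₀ : Stabilises (modelJ₀ r l s) P) (h₁ : Stabilises (modelJ₁ θ r l s) P)
    (hP : Module.finrank ℝ P = 2 * k) : ∃ x : PieceUnion r l s k, x.2.directSum = P := by
  let A := fun i => quaternionComponent hθ_pos hθ_lt h₀ h₁ i
  let B := complexComponent h₀
  let C := conjComponent h₀
  -- The index is built over the complex dimension computed from the components; that this equals
  -- `k` follows from `finrank_directSum` once the sum is known to be `P`.
  let c : PieceIndex r l s (2 * ∑ i, Module.finrank ℍ[ℝ] (A i) + Module.finrank ℂ B +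
      Module.finrank ℂ C) :=
    { t := fun i => Module.finrank ℍ[ℝ] (A i)
      l' := Module.finrank ℂ B
      s' := Module.finrank ℂ C
      t_le := fun i => (Submodule.finrank_le _).trans_eq (by
        rw [(WithLp.linearEquiv 2 ℍ[ℝ] (Fin (r i) → ℍ[ℝ])).finrank_eq, Module.finrank_fin_fun])
      l'_le := (Submodule.finrank_le _).trans_eq (by
        rw [(WithLp.linearEquiv 2 ℂ (Fin l → ℂ)).finrank_eq, Module.finrank_fin_fun])
      s'_le := (Submodule.finrank_le _).trans_eq (by
        rw [(WithLp.linearEquiv 2 ℂ (Fin s → ℂ)).finrank_eq, Module.finrank_fin_fun])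
      sum_eq := rfl }
  let p : Piece r l s _ c := (fun i => ⟨A i, rfl⟩, ⟨B, rfl⟩, ⟨C, rfl⟩)
  have hp : p.directSum = P := by
    ext x
    constructor
    · rintro ⟨hA, hB, hC⟩
      rw [← sum_embed x]
      exact P.add_mem (P.add_mem (P.sum_mem fun i _ => hA i) hB) hC
    · exact fun hx => ⟨fun i => embedQuaternion_mem hθ hθ_pos hθ_lt h₀ h₁ hx i,
        embedComplex_mem hθ hθ_pos hθ_lt h₀ h₁ hx, embedConj_mem hθ hθ_pos hθ_lt h₀ h₁ hx⟩
  have hk : 2 * ∑ i, Module.finrank ℍ[ℝ] (A i) + Module.finrank ℂ B + Module.finrank ℂ C = k := by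
    have := p.finrank_directSum
    rw [hp, hP] at this
    omega
  subst hk
  exact ⟨⟨c, p⟩, hp⟩

end DirectSum

/-! ### Real frames of a direct sum from frames of its factors -/

section Frames

variable {m : ℕ} {r : Fin m → ℕ} {l s k : ℕ}

/-- Tuples of frames of the factors of a piece. -/
abbrev PieceFrame (c : PieceIndex r l s k) : Type :=
  (∀ i, {v : Fin (c.t i) → QuaternionSpace (r i) // LinearIndependent ℍ[ℝ] v}) ×
    {v : Fin c.l' → ComplexSpace l // LinearIndependent ℂ v} ×
      {v : Fin c.s' → ComplexSpace s // LinearIndependent ℂ v}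

/-- The tuple of spans of a tuple of frames. -/
def Piece.ofFrame (c : PieceIndex r l s k) : PieceFrame c → Piece r l s k c :=
  Prod.map (Pi.map fun _ => Grass.ofFrame) (Prod.map Grass.ofFrame Grass.ofFrame)

/-- Openness is essential here: products of mere quotient maps need not be quotient maps. -/
theorem Piece.isOpenQuotientMap_ofFrame (c : PieceIndex r l s k) :
    IsOpenQuotientMap (Piece.ofFrame c) :=
  (IsOpenQuotientMap.piMap fun _ => Grass.isOpenQuotientMap_ofFrame).prodMap
    (Grass.isOpenQuotientMap_ofFrame.prodMap Grass.isOpenQuotientMap_ofFrame)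

/-- The index set of the complex basis of a piece that is associated with a tuple of frames. -/
abbrev ComplexIndex (c : PieceIndex r l s k) : Type :=
  (Σ i, Fin (c.t i) × Fin 2) ⊕ (Fin c.l' ⊕ Fin c.s')

theorem card_complexIndex (c : PieceIndex r l s k) : Fintype.card (ComplexIndex c) = k := by
  have := c.sum_eq
  simp only [Fintype.card_sum, Fintype.card_sigma, Fintype.card_prod, Fintype.card_fin,
    ← Finset.sum_mul]
  omega

/-- An enumeration of the index set. -/
def complexIndexEquiv (c : PieceIndex r l s k) : ComplexIndex c ≃ Fin k :=
  Fintype.equivFinOfCardEq (card_complexIndex c)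

/-- The quaternion `j`. -/
def quaternionJ : ℍ[ℝ] := ⟨0, 0, 1, 0⟩

@[simp] theorem quaternionJ_re : quaternionJ.re = 0 := rfl
@[simp] theorem quaternionJ_imI : quaternionJ.imI = 0 := rfl
@[simp] theorem quaternionJ_imJ : quaternionJ.imJ = 1 := rfl
@[simp] theorem quaternionJ_imK : quaternionJ.imK = 0 := rfl

/-- The complex basis of the direct sum associated with a tuple of frames. -/
def complexFrame {c : PieceIndex r l s k} (u : PieceFrame c) : ComplexIndex c → ModelSpace r l s :=
  Sum.elim (fun a => embedQuaternion r l s a.1 ((![1, quaternionJ] a.2.2 : ℍ[ℝ]) • (u.1 a.1).1 a.2.1))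
    (Sum.elim (fun a => embedComplex r l s (u.2.1.1 a)) (fun a => embedConj r l s (u.2.2.1 a)))

/-- The real basis of the direct sum consisting of the pairs `v, J₀ v` for `v` in the complex
basis. -/
def realFrame {c : PieceIndex r l s k} (u : PieceFrame c) :
    ComplexIndex c × Fin 2 → ModelSpace r l s :=
  fun a => ![complexFrame u a.1, modelJ₀ r l s (complexFrame u a.1)] a.2

/-- A quaternionic frame vector `v` gives the complex basis vectors `v` and `jv`; the four terms
match `v`, `iv`, `jv`, `ijv`. -/
theorem quaternion_eq_sum (q : ℍ[ℝ]) :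
    q = q.re • (1 : ℍ[ℝ]) + q.imI • (quaternionI * 1) + q.imJ • quaternionJ +
      q.imK • (quaternionI * quaternionJ) := by
  ext <;> simp

theorem span_realFrame {c : PieceIndex r l s k} (u : PieceFrame c) :
    Submodule.span ℝ (Set.range (realFrame u)) = (Piece.ofFrame c u).directSum := by
  apply le_antisymm
  · have h : ∀ a, complexFrame u a ∈ (Piece.ofFrame c u).directSum := by
      rintro (⟨i, a, e⟩ | a | a)
      · exact Piece.embedQuaternion_mem_iff.2 (Submodule.smul_mem _ _
          (Submodule.subset_span (Set.mem_range_self a)))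
      · exact Piece.embedComplex_mem_iff.2 (Submodule.subset_span (Set.mem_range_self a))
      · exact Piece.embedConj_mem_iff.2 (Submodule.subset_span (Set.mem_range_self a))
    rw [Submodule.span_le]
    rintro _ ⟨⟨a, e⟩, rfl⟩
    obtain rfl | rfl : e = 0 ∨ e = 1 := by omega
    · exact h a
    · exact Piece.modelMul_mem _ _ _ _ (h a)
  · set S := Submodule.span ℝ (Set.range (realFrame u))
    have h0 : ∀ a, complexFrame u a ∈ S := fun a =>
      Submodule.subset_span (Set.mem_range_self (a, (0 : Fin 2)))
    have h1 : ∀ a, modelJ₀ r l s (complexFrame u a) ∈ S := fun a =>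
      Submodule.subset_span (Set.mem_range_self (a, (1 : Fin 2)))
    have hq : ∀ i (q : ℍ[ℝ]) a, embedQuaternion r l s i (q • (u.1 i).1 a) ∈ S := fun i q a => by
      have h00 := h0 (Sum.inl ⟨i, a, 0⟩)
      have h01 := h0 (Sum.inl ⟨i, a, 1⟩)
      have h10 := h1 (Sum.inl ⟨i, a, 0⟩)
      have h11 := h1 (Sum.inl ⟨i, a, 1⟩)
      simp only [complexFrame, Sum.elim_inl, modelJ₀, modelMul_embedQuaternion, smul_smul] at h00 h01 h10 h11
      rw [quaternion_eq_sum q]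
      simp only [add_smul, smul_assoc, map_add, map_smul]
      exact S.add_mem (S.add_mem (S.add_mem (S.smul_mem _ h00) (S.smul_mem _ h10))
        (S.smul_mem _ h01)) (S.smul_mem _ h11)
    have hc : ∀ (z : ℂ) a, embedComplex r l s (z • u.2.1.1 a) ∈ S := fun z a => by
      have h := h1 (Sum.inr (Sum.inl a))
      simp only [complexFrame, Sum.elim_inl, Sum.elim_inr, modelJ₀, modelMul_embedComplex] at h
      rw [complex_smul_eq, map_add, map_smul, map_smul]
      exact S.add_mem (S.smul_mem _ (h0 (Sum.inr (Sum.inl a)))) (S.smul_mem _ h)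
    have hc' : ∀ (z : ℂ) a, embedConj r l s (z • u.2.2.1 a) ∈ S := fun z a => by
      have h := h1 (Sum.inr (Sum.inr a))
      simp only [complexFrame, Sum.elim_inr, modelJ₀, modelMul_embedConj] at h
      rw [complex_smul_eq, map_add, map_smul, map_smul]
      exact S.add_mem (S.smul_mem _ (h0 (Sum.inr (Sum.inr a)))) (S.smul_mem _ h)
    rintro x ⟨hx1, hx2, hx3⟩
    rw [← sum_embed x]
    refine S.add_mem (S.add_mem (S.sum_mem fun i _ => ?_) ?_) ?_
    · obtain ⟨q, hq'⟩ := (Submodule.mem_span_range_iff_exists_fun ℍ[ℝ]).1 (hx1 i)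
      rw [← hq', map_sum]
      exact S.sum_mem fun a _ => hq i (q a) a
    · obtain ⟨q, hq'⟩ := (Submodule.mem_span_range_iff_exists_fun ℂ).1 hx2
      rw [← hq', map_sum]
      exact S.sum_mem fun a _ => hc (q a) a
    · obtain ⟨q, hq'⟩ := (Submodule.mem_span_range_iff_exists_fun ℂ).1 hx3
      rw [← hq', map_sum]
      exact S.sum_mem fun a _ => hc' (q a) a

/-- The `2k` vectors span a space of dimension `2k`. -/
theorem linearIndependent_realFrame {c : PieceIndex r l s k} (u : PieceFrame c) :
    LinearIndependent ℝ (realFrame u) := by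
  rw [linearIndependent_iff_card_eq_finrank_span, Set.finrank, span_realFrame,
    Piece.finrank_directSum, Fintype.card_prod, card_complexIndex, Fintype.card_fin, mul_comm]

theorem continuous_realFrame (c : PieceIndex r l s k) :
    Continuous (realFrame (c := c)) := by
  have h : ∀ a, Continuous fun u : PieceFrame c => complexFrame u a := by
    rintro (⟨i, a, e⟩ | a | a)
    · refine (LinearMap.continuous_of_finiteDimensional _).comp ((continuous_const_smul _).comp ?_)
      exact (continuous_apply a).comp (continuous_subtype_val.comp
        ((continuous_apply i).comp continuous_fst))
    · refine (LinearMap.continuous_of_finiteDimensional _).comp ?_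
      exact (continuous_apply a).comp (continuous_subtype_val.comp
        (continuous_fst.comp continuous_snd))
    · refine (LinearMap.continuous_of_finiteDimensional _).comp ?_
      exact (continuous_apply a).comp (continuous_subtype_val.comp
        (continuous_snd.comp continuous_snd))
  refine continuous_pi fun ⟨a, e⟩ => ?_
  obtain rfl | rfl : e = 0 ∨ e = 1 := by omega
  · exact h a
  · exact (LinearMap.continuous_of_finiteDimensional _).comp (h a)

end Frames

/-! ### Compactness of the disjoint union -/

section Compact

instance (n d : ℕ) : CompactSpace (Grass ℍ[ℝ] (QuaternionSpace n) d) := by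
  refine Grass.compactSpace (fun a => ⟨star a, fun x y => ?_⟩) d
  simp only [PiLp.inner_apply, Quaternion.inner_def, PiLp.smul_apply]
  refine Finset.sum_congr rfl fun i _ => ?_
  simp
  ring

instance (n d : ℕ) : CompactSpace (Grass ℂ (ComplexSpace n) d) := by
  refine Grass.compactSpace (fun a => ⟨star a, fun x y => ?_⟩) d
  simp only [PiLp.inner_apply, Complex.inner, PiLp.smul_apply]
  refine Finset.sum_congr rfl fun i _ => ?_
  simp
  ring

instance {m : ℕ} (r : Fin m → ℕ) (l s k : ℕ) : Finite (PieceIndex r l s k) := by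
  let f : PieceIndex r l s k → (∀ i, Fin (r i + 1)) × Fin (l + 1) × Fin (s + 1) := fun c =>
    (fun i => ⟨c.t i, Nat.lt_succ_of_le (c.t_le i)⟩, ⟨c.l', Nat.lt_succ_of_le c.l'_le⟩,
      ⟨c.s', Nat.lt_succ_of_le c.s'_le⟩)
  refine Finite.of_injective f fun c c' h => ?_
  have h1 : c.t = c'.t := funext fun i => congrArg Fin.val (congrFun (congrArg Prod.fst h) i)
  have h2 : c.l' = c'.l' := congrArg (fun y => (Prod.fst (Prod.snd y)).val) h
  have h3 : c.s' = c'.s' := congrArg (fun y => (Prod.snd (Prod.snd y)).val) h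
  cases c
  cases c'
  cases h1
  cases h2
  cases h3
  rfl

instance {m : ℕ} (r : Fin m → ℕ) (l s k : ℕ) : CompactSpace (PieceUnion r l s k) :=
  inferInstanceAs (CompactSpace (Σ c : PieceIndex r l s k, Piece r l s k c))

end Compact

/-! ### Comparing the orientations of the two complex structures -/

section Orientations

variable {m : ℕ} {r : Fin m → ℕ} {l s k : ℕ}

/-- The quaternion `e^{-jt}`. -/
def quaternionExpJ (t : ℝ) : ℍ[ℝ] := ⟨Real.cos t, 0, -Real.sin t, 0⟩

@[simp] theorem quaternionExpJ_re (t : ℝ) : (quaternionExpJ t).re = Real.cos t := rfl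
@[simp] theorem quaternionExpJ_imI (t : ℝ) : (quaternionExpJ t).imI = 0 := rfl
@[simp] theorem quaternionExpJ_imJ (t : ℝ) : (quaternionExpJ t).imJ = -Real.sin t := rfl
@[simp] theorem quaternionExpJ_imK (t : ℝ) : (quaternionExpJ t).imK = 0 := rfl

theorem quaternionExpJ_mul (a b : ℝ) :
    quaternionExpJ a * quaternionExpJ b = quaternionExpJ (a + b) := by
  ext <;> simp [Real.cos_add, Real.sin_add]

theorem quaternionExpJ_zero : quaternionExpJ 0 = 1 := by
  ext <;> simp

/-- Since `i` and `j` anticommute, `ie^{jt} e^{-jt/2} = ie^{jt/2} = e^{-jt/2} i`. Left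
multiplication by `e^{-jt/2}` thus carries the first structure of `ℍ_t` to the second. -/
theorem quaternionRot_mul_quaternionExpJ (t : ℝ) :
    quaternionRot t * quaternionExpJ (t / 2) = quaternionExpJ (t / 2) * quaternionI := by
  obtain ⟨a, rfl⟩ : ∃ a, t = a + a := ⟨t / 2, by ring⟩
  rw [show (a + a) / 2 = a by ring]
  have h := Real.sin_sq_add_cos_sq a
  ext <;> simp [Real.cos_add, Real.sin_add]
  · linear_combination Real.cos a * h
  · linear_combination Real.sin a * h

/-- Multiplication by the quaternions `e^{-j t_i}` on the quaternionic factors. -/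
def Piece.rotate {c : PieceIndex r l s k} (p : Piece r l s k c) (t : Fin m → ℝ) :
    p.directSum ≃ₗ[ℝ] p.directSum :=
  LinearEquiv.ofLinearMap
    ((modelMul r l s (fun i => quaternionExpJ (t i)) 1 1).restrict fun _ => p.modelMul_mem _ _ _)
    ((modelMul r l s (fun i => quaternionExpJ (-t i)) 1 1).restrict fun _ => p.modelMul_mem _ _ _)
    (LinearMap.ext fun x => Subtype.ext (by
      refine (modelMul_modelMul _ _ _ _ _ _ _).trans (ModelSpace.ext (fun i => ?_) ?_ ?_) <;>
        simp [quaternionExpJ_mul, quaternionExpJ_zero]))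
    (LinearMap.ext fun x => Subtype.ext (by
      refine (modelMul_modelMul _ _ _ _ _ _ _).trans (ModelSpace.ext (fun i => ?_) ?_ ?_) <;>
        simp [quaternionExpJ_mul, quaternionExpJ_zero]))

theorem Piece.coe_rotate {c : PieceIndex r l s k} (p : Piece r l s k c) (t : Fin m → ℝ)
    (x : p.directSum) : (p.rotate t x : ModelSpace r l s) =
      modelMul r l s (fun i => quaternionExpJ (t i)) 1 1 x := rfl

/-- The rotation is the square of the rotation by half the angles. -/
theorem Piece.det_rotate_pos {c : PieceIndex r l s k} (p : Piece r l s k c) (t : Fin m → ℝ) :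
    0 < LinearMap.det (p.rotate t : p.directSum →ₗ[ℝ] p.directSum) := by
  have h : (p.rotate t : p.directSum →ₗ[ℝ] p.directSum) =
      (p.rotate (fun i => t i / 2) : p.directSum →ₗ[ℝ] p.directSum) ∘ₗ
        (p.rotate (fun i => t i / 2) : p.directSum →ₗ[ℝ] p.directSum) := by
    refine LinearMap.ext fun x => Subtype.ext ?_
    refine Eq.trans ?_ (modelMul_modelMul _ _ _ _ _ _ _).symm
    change modelMul r l s _ 1 1 _ = _
    congr 2
    · ext1 i
      simp [quaternionExpJ_mul]
    · simp
    · simp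
  rw [h, LinearMap.det_comp]
  exact mul_self_pos.2 (LinearEquiv.isUnit_det' _).ne_zero

/-- The real basis of the direct sum associated with a tuple of frames. -/
def realBasis {c : PieceIndex r l s k} (u : PieceFrame c) :
    Module.Basis (ComplexIndex c × Fin 2) ℝ (Piece.ofFrame c u).directSum :=
  (Module.Basis.span (linearIndependent_realFrame u)).map (LinearEquiv.ofEq _ _ (span_realFrame u))

theorem coe_realBasis {c : PieceIndex r l s k} (u : PieceFrame c) (a : ComplexIndex c × Fin 2) :
    (realBasis u a : ModelSpace r l s) = realFrame u a :=
  congrArg Subtype.val (Module.Basis.span_apply (linearIndependent_realFrame u) a)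

/-- The signs by which `J₀` and `J₁` differ. -/
def conjSign (c : PieceIndex r l s k) : ComplexIndex c × Fin 2 → ℝˣ :=
  fun a => Sum.elim 1 (Sum.elim 1 fun _ => ![1, -1] a.2) a.1

theorem prod_conjSign (c : PieceIndex r l s k) : ∏ a, conjSign c a = (-1) ^ c.s' := by
  simp [conjSign, Fintype.prod_prod_type]

/-- The real basis of the direct sum consisting of pairs `v, J₁ v`. -/
def realBasisSnd (θ : Fin m → ℝ) {c : PieceIndex r l s k} (u : PieceFrame c) :
    Module.Basis (ComplexIndex c × Fin 2) ℝ (Piece.ofFrame c u).directSum :=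
  ((realBasis u).unitsSMul (conjSign c)).map ((Piece.ofFrame c u).rotate fun i => θ i / 2)

theorem realBasis_one {c : PieceIndex r l s k} (u : PieceFrame c) (a : ComplexIndex c) :
    (realBasis u (a, 1) : ModelSpace r l s) = modelJ₀ r l s (realBasis u (a, 0)) := by
  rw [coe_realBasis, coe_realBasis]
  rfl

/-- On the quaternionic factors the rotation turns pairs for `i` into pairs for `ie^{jθ}`; on `ℂ̄^s`
the sign turns `(v, iv)` into `(v, -iv)`; on `ℂ^ℓ` nothing changes. -/
theorem realBasisSnd_one (θ : Fin m → ℝ) {c : PieceIndex r l s k} (u : PieceFrame c)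
    (a : ComplexIndex c) : (realBasisSnd θ u (a, 1) : ModelSpace r l s) =
      modelJ₁ θ r l s (realBasisSnd θ u (a, 0)) := by
  have h : ∀ e, (realBasisSnd θ u (a, e) : ModelSpace r l s) =
      modelMul r l s (fun i => quaternionExpJ (θ i / 2)) 1 1
        ((conjSign c (a, e) : ℝ) • realFrame u (a, e)) := by
    intro e
    rw [realBasisSnd, Module.Basis.map_apply, Piece.coe_rotate, Module.Basis.unitsSMul_apply,
      ← coe_realBasis]
    rfl
  rw [h, h]
  have h0 : realFrame u (a, 0) = complexFrame u a := rfl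
  have h1 : realFrame u (a, 1) = modelJ₀ r l s (complexFrame u a) := rfl
  rw [h0, h1]
  rcases a with (⟨i, a, e⟩ | a | a)
  · simp [complexFrame, conjSign, modelJ₀, modelJ₁, modelMul_embedQuaternion, smul_smul,
      ← mul_assoc, quaternionRot_mul_quaternionExpJ]
  · simp [complexFrame, conjSign, modelJ₀, modelJ₁, modelMul_embedComplex]
  · simp [complexFrame, conjSign, modelJ₀, modelJ₁, modelMul_embedConj]

theorem orientation_realBasisSnd_eq_iff (θ : Fin m → ℝ) {c : PieceIndex r l s k}
    (u : PieceFrame c) :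
    (realBasisSnd θ u).orientation = (realBasis u).orientation ↔ Even c.s' := by
  rw [realBasisSnd, (Module.Basis.orientation_comp_linearEquiv_eq_iff_det_pos _ _).2
    (Piece.det_rotate_pos _ _), Module.Basis.orientation_unitsSMul, prod_conjSign]
  obtain h | h := Nat.even_or_odd c.s'
  · simp [h, h.neg_one_pow]
  · rw [h.neg_one_pow]
    simp only [inv_neg, inv_one, Module.Ray.neg_units_smul, one_smul]
    exact iff_of_false (Module.Ray.ne_neg_self _).symm (Nat.not_even_iff_odd.2 h)

end Orientations

/-! ### Transport to `V`, continuity, and the image -/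

section Embedding

variable {V : Type*} [NormedAddCommGroup V] [InnerProductSpace ℝ V]
  {J₀ J₁ : V →ₗ[ℝ] V} {m : ℕ} {θ : Fin m → ℝ} {r : Fin m → ℕ} {l s k : ℕ}
  {φ : ModelSpace r l s ≃ₗᵢ[ℝ] V}

/-- The image in `V` of the direct sum. -/
abbrev PieceUnion.image (φ : ModelSpace r l s ≃ₗᵢ[ℝ] V) (x : PieceUnion r l s k) :
    Submodule ℝ V :=
  x.2.directSum.map φ.toLinearEquiv.toLinearMap

theorem PieceUnion.finrank_image (φ : ModelSpace r l s ≃ₗᵢ[ℝ] V) (x : PieceUnion r l s k) :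
    Module.finrank ℝ (x.image φ) = 2 * k :=
  (LinearEquiv.finrank_map_eq φ.toLinearEquiv _).trans x.2.finrank_directSum

theorem PieceUnion.image_injective (φ : ModelSpace r l s ≃ₗᵢ[ℝ] V) :
    Function.Injective (PieceUnion.image (k := k) φ) :=
  (Submodule.map_injective_of_injective φ.injective).comp PieceUnion.directSum_injective

/-- The images of the two real bases of the direct sum induce the orientations of `J₀` and `J₁`. -/
theorem inducesOrientation_map (hφ : IsPairIso (modelJ₀ r l s) (modelJ₁ θ r l s) J₀ J₁ φ)
    {c : PieceIndex r l s k} (u : PieceFrame c) :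
    let e := φ.toLinearEquiv.submoduleMap (Piece.ofFrame c u).directSum
    InducesOrientation J₀ (PieceUnion.image φ ⟨c, Piece.ofFrame c u⟩)
      (((realBasis u).map e).reindex (pairIndex (complexIndexEquiv c))).orientation ∧
    InducesOrientation J₁ (PieceUnion.image φ ⟨c, Piece.ofFrame c u⟩)
      (((realBasisSnd θ u).map e).reindex (pairIndex (complexIndexEquiv c))).orientation := by
  intro e
  refine ⟨inducesOrientation_of_basis _ _ fun a => ?_, inducesOrientation_of_basis _ _ fun a => ?_⟩
  · change φ (realBasis u (a, 1)) = J₀ (φ (realBasis u (a, 0)))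
    rw [realBasis_one, hφ.map_fst]
  · change φ (realBasisSnd θ u (a, 1)) = J₁ (φ (realBasisSnd θ u (a, 0)))
    rw [realBasisSnd_one, hφ.map_snd]

theorem PieceUnion.exists_ofFrame (x : PieceUnion r l s k) :
    ∃ (c : PieceIndex r l s k) (u : PieceFrame c), x = ⟨c, Piece.ofFrame c u⟩ := by
  obtain ⟨c, p⟩ := x
  obtain ⟨u, rfl⟩ := (Piece.isOpenQuotientMap_ofFrame c).surjective p
  exact ⟨c, u, rfl⟩

theorem PieceUnion.exists_inducesOrientation
    (hφ : IsPairIso (modelJ₀ r l s) (modelJ₁ θ r l s) J₀ J₁ φ) (x : PieceUnion r l s k) :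
    ∃ o : Orientation ℝ (x.image φ) (Fin (2 * k)), InducesOrientation J₀ (x.image φ) o := by
  obtain ⟨c, u, rfl⟩ := x.exists_ofFrame
  exact ⟨_, (inducesOrientation_map hφ u).1⟩

/-- The image in `V` of the direct sum, with the orientation induced by `J₀`. -/
def orientedImage (hφ : IsPairIso (modelJ₀ r l s) (modelJ₁ θ r l s) J₀ J₁ φ)
    (x : PieceUnion r l s k) : OrientedGrass V (2 * k) where
  plane := x.image φ
  finrank_eq := x.finrank_image φ
  orientation := (x.exists_inducesOrientation hφ).choose

theorem orientedImage_injective (hφ : IsPairIso (modelJ₀ r l s) (modelJ₁ θ r l s) J₀ J₁ φ) :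
    Function.Injective (orientedImage (k := k) hφ) := fun _ _ h =>
  PieceUnion.image_injective φ (congrArg OrientedGrass.plane h)

/-- Continuity is checked on tuples of frames, where the map becomes the oriented span of the frame
`φ ∘ realFrame u`, reordered. -/
theorem continuous_orientedImage [FiniteDimensional ℝ V] (hJ₀ : IsOrthogonalComplexStructure J₀)
    (hφ : IsPairIso (modelJ₀ r l s) (modelJ₁ θ r l s) J₀ J₁ φ) :
    Continuous (orientedImage (k := k) hφ) := by
  refine continuous_sigma fun c => ?_
  rw [(Piece.isOpenQuotientMap_ofFrame c).isQuotientMap.continuous_iff]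
  let F : PieceFrame c → {v : Fin (2 * k) → V // LinearIndependent ℝ v} := fun u =>
    ⟨fun n => φ (realFrame u ((pairIndex (complexIndexEquiv c)).symm n)),
      ((linearIndependent_realFrame u).comp _ (Equiv.injective _)).map' φ.toLinearEquiv.toLinearMap
        (LinearEquiv.ker _)⟩
  have hF : Continuous F := by
    refine Continuous.subtype_mk (continuous_pi fun n => φ.continuous.comp ?_) _
    exact continuous_pi_iff.1 (continuous_realFrame c) _
  have h : ((fun p => orientedImage hφ ⟨c, p⟩) ∘ Piece.ofFrame c) = OrientedGrass.ofFrame ∘ F := by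
    funext u
    refine OrientedGrass.mk_eq_ofFrame _ (((realBasis u).map (φ.toLinearEquiv.submoduleMap _)).reindex
      (pairIndex (complexIndexEquiv c))) (fun n => ?_) ?_
    · rw [Module.Basis.reindex_apply]
      exact congrArg φ (coe_realBasis u _)
    -- The orientation of `orientedImage` is an arbitrary choice by definition; uniqueness
    -- identifies it with that of the frame.
    · exact (inducesOrientation_map hφ u).1.unique hJ₀.sq (Exists.choose_spec _)
  exact h ▸ OrientedGrass.continuous_ofFrame.comp hF

theorem stabilises_map_iff {E : Type*} [NormedAddCommGroup E] [InnerProductSpace ℝ E]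
    {φ : E ≃ₗᵢ[ℝ] V} {J : E →ₗ[ℝ] E} {J' : V →ₗ[ℝ] V} (h : ∀ x, φ (J x) = J' (φ x))
    (P : Submodule ℝ E) : Stabilises J' (P.map φ.toLinearEquiv.toLinearMap) ↔ Stabilises J P := by
  have hc : J' ∘ₗ φ.toLinearEquiv.toLinearMap = φ.toLinearEquiv.toLinearMap ∘ₗ J :=
    LinearMap.ext fun x => (h x).symm
  unfold Stabilises
  rw [← Submodule.map_comp, hc, Submodule.map_comp]
  exact (Submodule.map_injective_of_injective φ.injective).eq_iff

theorem exists_image_eq (hθ : StrictMono θ) (hθ_pos : ∀ i, 0 < θ i) (hθ_lt : ∀ i, θ i < Real.pi)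
    (hφ : IsPairIso (modelJ₀ r l s) (modelJ₁ θ r l s) J₀ J₁ φ) {P : Submodule ℝ V}
    (h₀ : Stabilises J₀ P) (h₁ : Stabilises J₁ P) (hP : Module.finrank ℝ P = 2 * k) :
    ∃ x : PieceUnion r l s k, x.image φ = P := by
  obtain ⟨P, rfl⟩ : ∃ P', P'.map φ.toLinearEquiv.toLinearMap = P :=
    ⟨P.comap φ.toLinearEquiv.toLinearMap, Submodule.map_comap_eq_of_surjective φ.surjective P⟩
  rw [stabilises_map_iff hφ.map_fst] at h₀
  rw [stabilises_map_iff hφ.map_snd] at h₁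
  rw [LinearEquiv.finrank_map_eq] at hP
  obtain ⟨x, hx⟩ := exists_directSum_eq hθ hθ_pos hθ_lt h₀ h₁ hP
  exact ⟨x, by rw [PieceUnion.image, hx]⟩

theorem orientedImage_mem (hφ : IsPairIso (modelJ₀ r l s) (modelJ₁ θ r l s) J₀ J₁ φ)
    (x : PieceUnion r l s k) : orientedImage hφ x ∈ stabilisedComplexPlanes J₀ J₁ k :=
  ⟨(stabilises_map_iff hφ.map_fst _).2 x.2.stabilises_modelJ₀,
    (stabilises_map_iff hφ.map_snd _).2 (x.2.stabilises_modelJ₁ θ), Exists.choose_spec _⟩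

theorem eq_or_eq_reverse_orientedImage [FiniteDimensional ℝ V]
    (hφ : IsPairIso (modelJ₀ r l s) (modelJ₁ θ r l s) J₀ J₁ φ) (x : PieceUnion r l s k)
    (Q : OrientedGrass V (2 * k)) (h : x.image φ = Q.plane) :
    Q = orientedImage hφ x ∨ Q = (orientedImage hφ x).reverse := by
  obtain ⟨P, hP, o⟩ := Q
  dsimp only at h
  subst h
  obtain h | h := Orientation.eq_or_eq_neg o (orientedImage hφ x).orientation
    (by rw [Fintype.card_fin]; exact hP.symm)
  · left
    rw [h]
    rfl
  · right
    rw [h]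
    rfl

theorem eq_orientedImage [FiniteDimensional ℝ V] (hJ₀ : IsOrthogonalComplexStructure J₀)
    (hφ : IsPairIso (modelJ₀ r l s) (modelJ₁ θ r l s) J₀ J₁ φ) (x : PieceUnion r l s k)
    (Q : OrientedGrass V (2 * k)) (h : x.image φ = Q.plane)
    (hQ : InducesOrientation J₀ Q.plane Q.orientation) : orientedImage hφ x = Q := by
  obtain ⟨P, hP, o⟩ := Q
  dsimp only at h
  subst h
  have : (orientedImage hφ x).orientation = o :=
    InducesOrientation.unique hJ₀.sq (orientedImage_mem hφ x).2.2 hQ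
  rw [← this]
  rfl

theorem range_orientedImage [FiniteDimensional ℝ V] (hJ₀ : IsOrthogonalComplexStructure J₀)
    (hθ : StrictMono θ) (hθ_pos : ∀ i, 0 < θ i) (hθ_lt : ∀ i, θ i < Real.pi)
    (hφ : IsPairIso (modelJ₀ r l s) (modelJ₁ θ r l s) J₀ J₁ φ) :
    Set.range (orientedImage hφ) = stabilisedComplexPlanes J₀ J₁ k := by
  refine Set.Subset.antisymm (Set.range_subset_iff.2 (orientedImage_mem hφ)) ?_
  rintro Q ⟨h₀, h₁, hQ⟩
  obtain ⟨x, hx⟩ := exists_image_eq hθ hθ_pos hθ_lt hφ h₀ h₁ Q.finrank_eq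
  exact ⟨x, eq_orientedImage hJ₀ hφ x Q hx hQ⟩

theorem OrientedGrass.reverse_ne {d : ℕ} (Q : OrientedGrass V d) : Q.reverse ≠ Q := by
  intro h
  obtain ⟨P, hP, o⟩ := Q
  simp only [OrientedGrass.reverse, OrientedGrass.mk.injEq, heq_eq_eq, true_and] at h
  exact Module.Ray.ne_neg_self o h.symm

theorem OrientedGrass.reverse_injective {d : ℕ} :
    Function.Injective (OrientedGrass.reverse (V := V) (d := d)) := by
  refine Function.LeftInverse.injective (g := OrientedGrass.reverse) fun Q => ?_
  obtain ⟨P, hP, o⟩ := Q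
  exact congrArg (OrientedGrass.mk P hP) (neg_neg o)

/-- A coincidence between the two copies has equal planes, hence equal arguments, and no oriented
plane is its own reverse, even in dimension zero. -/
theorem sumElim_orientedImage_injective
    (hφ : IsPairIso (modelJ₀ r l s) (modelJ₁ θ r l s) J₀ J₁ φ) :
    Function.Injective (Sum.elim (orientedImage (k := k) hφ)
      (OrientedGrass.reverse ∘ orientedImage hφ)) := by
  refine (orientedImage_injective hφ).sumElim
    (OrientedGrass.reverse_injective.comp (orientedImage_injective hφ)) fun x y h => ?_
  obtain rfl : x = y := PieceUnion.image_injective φ (congrArg OrientedGrass.plane h)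
  exact OrientedGrass.reverse_ne _ h.symm

theorem range_sumElim_orientedImage [FiniteDimensional ℝ V]
    (hθ : StrictMono θ) (hθ_pos : ∀ i, 0 < θ i) (hθ_lt : ∀ i, θ i < Real.pi)
    (hφ : IsPairIso (modelJ₀ r l s) (modelJ₁ θ r l s) J₀ J₁ φ) :
    Set.range (Sum.elim (orientedImage hφ) (OrientedGrass.reverse ∘ orientedImage hφ)) =
      stabilisedPlanes J₀ J₁ k := by
  refine Set.Subset.antisymm (Set.range_subset_iff.2 ?_) ?_
  · rintro (x | x)
    · exact ⟨(orientedImage_mem hφ x).1, (orientedImage_mem hφ x).2.1⟩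
    · exact ⟨(orientedImage_mem hφ x).1, (orientedImage_mem hφ x).2.1⟩
  · rintro Q ⟨h₀, h₁⟩
    obtain ⟨x, hx⟩ := exists_image_eq hθ hθ_pos hθ_lt hφ h₀ h₁ Q.finrank_eq
    obtain h | h := eq_or_eq_reverse_orientedImage hφ x Q hx
    · exact ⟨Sum.inl x, h.symm⟩
    · exact ⟨Sum.inr x, h.symm⟩

theorem induceSameOrientation_orientedImage_iff [FiniteDimensional ℝ V] (hJ₀ : IsOrthogonalComplexStructure J₀)
    (hJ₁ : IsOrthogonalComplexStructure J₁)
    (hφ : IsPairIso (modelJ₀ r l s) (modelJ₁ θ r l s) J₀ J₁ φ) (x : PieceUnion r l s k) :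
    InduceSameOrientation J₀ J₁ (orientedImage hφ x) ↔ Even x.1.s' := by
  obtain ⟨c, u, rfl⟩ := x.exists_ofFrame
  obtain ⟨h₀, h₁⟩ := inducesOrientation_map hφ u
  rw [← orientation_realBasisSnd_eq_iff θ u]
  simp only [Module.Basis.orientation_reindex, Module.Basis.orientation_map] at h₀ h₁
  constructor
  · rintro ⟨o, ho₀, ho₁⟩
    have h := (InducesOrientation.unique hJ₁.sq h₁ ho₁).trans
      (InducesOrientation.unique hJ₀.sq ho₀ h₀)
    exact (Orientation.map _ _).injective ((Orientation.reindex _ _ _).injective h)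
  · intro h
    rw [h] at h₁
    exact ⟨_, h₀, h₁⟩

end Embedding

end

theorem theorem4p2 {V : Type*} [NormedAddCommGroup V] [InnerProductSpace ℝ V]
    [FiniteDimensional ℝ V] (J₀ J₁ : V →ₗ[ℝ] V)
    (hJ₀ : IsOrthogonalComplexStructure J₀) (hJ₁ : IsOrthogonalComplexStructure J₁)
    {m : ℕ} (θ : Fin m → ℝ) (hθ : StrictMono θ) (hθ_pos : ∀ i, 0 < θ i)
    (hθ_lt : ∀ i, θ i < Real.pi) (r : Fin m → ℕ) (hr : ∀ i, 0 < r i) (l s : ℕ)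
    (φ : ModelSpace r l s ≃ₗᵢ[ℝ] V)
    (hφ : IsPairIso (modelJ₀ r l s) (modelJ₁ θ r l s) J₀ J₁ φ) (k : ℕ) :
    ∃ Ψ : PieceUnion r l s k → OrientedGrass V (2 * k),
      -- `Ψ` sends `(P₁, …, P_m, P', P'')` to the plane `φ(P₁ ⊕ ⋯ ⊕ P_m ⊕ P' ⊕ P'')`
      (∀ x, (Ψ x).plane = x.2.directSum.map φ.toLinearEquiv.toLinearMap) ∧
      -- the disjoint union is homeomorphic, via `Ψ`, to the space of stabilised planes
      -- oriented by `J₀`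
      Topology.IsEmbedding Ψ ∧
      Set.range Ψ = stabilisedComplexPlanes J₀ J₁ k ∧
      -- allowing both orientations gives two disjoint copies
      Topology.IsEmbedding (Sum.elim Ψ (OrientedGrass.reverse ∘ Ψ)) ∧
      Set.range (Sum.elim Ψ (OrientedGrass.reverse ∘ Ψ)) = stabilisedPlanes J₀ J₁ k ∧
      -- the pieces on which `J₀` and `J₁` induce the same orientation
      ∀ x, InduceSameOrientation J₀ J₁ (Ψ x) ↔ Even x.1.s' := by
  have hc := continuous_orientedImage (k := k) hJ₀ hφ
  exact ⟨orientedImage hφ, fun _ => rfl,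
    -- A continuous injection from a compact space to a Hausdorff space is a closed embedding.
    (hc.isClosedEmbedding (orientedImage_injective hφ)).isEmbedding,
    range_orientedImage hJ₀ hθ hθ_pos hθ_lt hφ,
    ((hc.sumElim (OrientedGrass.continuous_reverse.comp hc)).isClosedEmbedding
      (sumElim_orientedImage_injective hφ)).isEmbedding,
    range_sumElim_orientedImage hθ hθ_pos hθ_lt hφ,
    induceSameOrientation_orientedImage_iff hJ₀ hJ₁ hφ⟩
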